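/- Let $d\ge 1$, let $B_d$ be the open unit ball of $\mathbb C^d$, $S_d=\partial B_d$ the unit sphere with normalized Lebesgue measure $\sigma$, and $\mathbb D$ the open unit disk. For a function $f$ on $B_d$ and $\zeta\in S_d$ write $f(\zeta)=\lim_{r\to1-}f(r\zeta)$ when this radial limit exists. Let $\mu$ be a finite positive Borel measure on $\overline{B}_d$ and let $\mu|_{S_d}$ be its restriction to the sphere. A holomorphic function $f$ on $B_d$ is called $\mu$-admissible if its radial limits exist at $\mu$-almost every point of $S_d$; then $\|f\|_{L^2(\overline B_d,\mu)}\in[0,+\infty]$ is defined using the values of $f$ in $B_d$ and its radial limits on $S_d$. For a holomorphic function $b:B_d\to\mathbb D$, the de Branges--Rovnyak space $\mathcal H(b)$ is the reproducing kernel Hilbert space on $B_d$ with kernel $$k^b(z,w)=\frac{1-b(z)\overline{b(w)}}{(1-\langle z,w\rangle)^d},\qquad z,w\in B_d,$$ and $\mu$ is called a reverse Carleson measure for $\mathcal H(b)$ if there is a constant $C>0$ such that $\|f\|_{\mathcal H(b)}\le C\|f\|_{L^2(\overline B_d,\mu)}$ for all $\mu$-admissible $f\in\mathcal H(b)$. The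 function $b$ is called inner if $|b(\zeta)|=1$ for $\sigma$-almost all $\zeta\in S_d$ (radial limits of $b$ exist $\sigma$-almost everywhere). Assume that $b:B_d\to\mathbb D$ is holomorphic, $\mu$-admissible and not inner, and that $\mu$ is a reverse Carleson measure for $\mathcal H(b)$. Then the Radon--Nikodym derivative (with respect to $\sigma$) of the absolutely continuous part of $\mu|_{S_d}$ is not zero $\sigma$-almost everywhere, that is, $$\frac{d\mu|_{S_d}}{d\sigma}\neq 0 \quad\text{in } L^1(\sigma),$$ and $$\int_{\{\zeta\in S_d:\ |b(\zeta)|<1\}}\frac{1}{1-|b|}\,d\sigma<\infty .$$ -/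

import Mathlib

open scoped NNReal
open MeasureTheory Metric Set Filter Topology InnerProductSpace ComplexConjugate

noncomputable section
namespace DeBrangesRovnyak

/-- The complex Euclidean space `ℂᵈ`. -/
abbrev Cn (d : ℕ) : Type := EuclideanSpace ℂ (Fin d)
/-- The open unit ball `B_d`. -/
abbrev Ball (d : ℕ) : Type := ball (0 : Cn d) 1
/-- The closed unit ball. -/
abbrev ClosedBall (d : ℕ) : Type := closedBall (0 : Cn d) 1
/-- The unit sphere `S_d = ∂B_d`. -/
abbrev Sphere (d : ℕ) : Type := sphere (0 : Cn d) 1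

/-- The normalized Lebesgue measure `σ` on the unit sphere. -/
def sigma (d : ℕ) : Measure (Sphere d) :=
  ((volume : Measure (Cn d)).toSphere univ)⁻¹ • (volume : Measure (Cn d)).toSphere

section SzegoPositivity
variable {d : ℕ}

instance [NeZero d] : IsProbabilityMeasure (sigma d) := by
  constructor
  have h0 : (volume : Measure (Cn d)).toSphere univ ≠ 0 := by
    rw [Ne, Measure.measure_univ_eq_zero]
    exact Measure.toSphere_ne_zero _
  simp only [sigma, Measure.smul_apply, smul_eq_mul]
  exact ENNReal.inv_mul_cancel h0 (measure_ne_top _ _)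

/-- The isometry of the sphere induced by a linear isometry. -/
def sphereMap (T : Cn d ≃ₗᵢ[ℂ] Cn d) : Sphere d ≃ᵐ Sphere d :=
  (T.toHomeomorph.subtype (p := fun x => x ∈ sphere (0 : Cn d) 1)
    (q := fun x => x ∈ sphere (0 : Cn d) 1) (by intro x; simp)).toMeasurableEquiv

lemma sphereMap_coe (T : Cn d ≃ₗᵢ[ℂ] Cn d) (x : Sphere d) : (sphereMap T x : Cn d) = T x := rfl

open scoped Pointwise in
lemma measurePreserving_sphereMap (T : Cn d ≃ₗᵢ[ℂ] Cn d) :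
    MeasurePreserving (sphereMap T) (sigma d) (sigma d) := by
  have key : MeasurePreserving (sphereMap T) (volume : Measure (Cn d)).toSphere
      (volume : Measure (Cn d)).toSphere := by
    refine ⟨(sphereMap T).measurable, ?_⟩
    ext s hs
    rw [Measure.map_apply (sphereMap T).measurable hs, Measure.toSphere_apply' _ hs,
      Measure.toSphere_apply' _ ((sphereMap T).measurable hs)]
    have hv : MeasurePreserving T (volume : Measure (Cn d)) volume :=
      (LinearIsometryEquiv.measurePreserving
        ({ T.toLinearEquiv.restrictScalars ℝ with norm_map' := T.norm_map } : Cn d ≃ₗᵢ[ℝ] Cn d))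
    congr 1
    rw [← hv.measure_preimage_equiv (f := T.toHomeomorph.toMeasurableEquiv)
      (Ioo (0 : ℝ) 1 • (Subtype.val '' s))]
    congr 1
    ext x
    simp only [Set.mem_smul, mem_image, mem_preimage]
    constructor
    · rintro ⟨r, hr, _, ⟨y, hy, rfl⟩, rfl⟩
      refine ⟨r, hr, _, ⟨_, hy, rfl⟩, ?_⟩
      change r • T y = T (r • (y : Cn d))
      exact (T.toLinearEquiv.restrictScalars ℝ).map_smul r (y : Cn d) |>.symm
    · rintro ⟨r, hr, _, ⟨y, hy, rfl⟩, hx⟩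
      refine ⟨r, hr, _, ⟨(sphereMap T).symm y, by simpa using hy, rfl⟩, ?_⟩
      apply T.injective
      change _ = T x at hx
      rw [← hx]
      have := (T.toLinearEquiv.restrictScalars ℝ).map_smul r ((sphereMap T).symm y : Cn d)
      refine this.trans ?_
      change r • T ((sphereMap T).symm y : Cn d) = _
      rw [← sphereMap_coe]; simp
  exact key.smul_measure _

lemma integral_sphere_comp (T : Cn d ≃ₗᵢ[ℂ] Cn d) (g : Cn d → ℂ) :
    ∫ x : Sphere d, g (T x) ∂sigma d = ∫ x : Sphere d, g x ∂sigma d :=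
  (measurePreserving_sphereMap T).integral_comp' (fun x : Sphere d => g x)

/-- The linear isometry multiplying `u` by `α` and the orthogonal complement of `u` by `l`. -/
lemma exists_twist (u : Cn d) (hu : ‖u‖ = 1) (α l : ℂ) (hα : ‖α‖ = 1) (hl : ‖l‖ = 1) :
    ∃ T : Cn d ≃ₗᵢ[ℂ] Cn d, ∀ z, T z = (α * ⟪u, z⟫_ℂ) • u + l • (z - ⟪u, z⟫_ℂ • u) := by
  have huu : ⟪u, u⟫_ℂ = 1 := by rw [inner_self_eq_norm_sq_to_K, hu]; simp
  let L : Cn d →ₗ[ℂ] Cn d :=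
    { toFun := fun z => (α * ⟪u, z⟫_ℂ) • u + l • (z - ⟪u, z⟫_ℂ • u)
      map_add' := by intro x y; simp only [inner_add_right]; module
      map_smul' := by intro c x; simp only [inner_smul_right, RingHom.id_apply]; module }
  have hL : ∀ z, ‖L z‖ = ‖z‖ := by
    intro z
    have horth : ⟪u, z - ⟪u, z⟫_ℂ • u⟫_ℂ = 0 := by
      rw [inner_sub_right, inner_smul_right, huu]; ring
    have h1 := norm_add_sq_eq_norm_sq_add_norm_sq_of_inner_eq_zero (𝕜 := ℂ)
      ((α * ⟪u, z⟫_ℂ) • u) (l • (z - ⟪u, z⟫_ℂ • u))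
      (by rw [inner_smul_left, inner_smul_right, horth]; simp)
    have h2 := norm_add_sq_eq_norm_sq_add_norm_sq_of_inner_eq_zero (𝕜 := ℂ)
      (⟪u, z⟫_ℂ • u) (z - ⟪u, z⟫_ℂ • u)
      (by rw [inner_smul_left, horth]; simp)
    rw [add_sub_cancel] at h2
    simp only [norm_smul, norm_mul, hα, hl, one_mul, hu, mul_one] at h1 h2
    have : ‖L z‖ * ‖L z‖ = ‖z‖ * ‖z‖ := by rw [h2]; exact h1
    exact (mul_self_inj_of_nonneg (norm_nonneg _) (norm_nonneg _)).1 this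
  exact ⟨LinearIsometry.toLinearIsometryEquiv ⟨L, hL⟩ rfl, fun z => rfl⟩

lemma integrable_sphere [NeZero d] {g : Sphere d → ℂ} (hg : Continuous g) :
    Integrable g (sigma d) := by
  obtain ⟨C, hC⟩ := isCompact_univ.exists_bound_of_continuousOn (f := g) hg.continuousOn
  exact Integrable.of_bound hg.aestronglyMeasurable C (ae_of_all _ fun x => hC x (mem_univ _))


lemma sphere_norm (x : Sphere d) : ‖(x : Cn d)‖ = 1 := by simp

lemma continuous_sphere {f : Cn d → ℂ} {R : ℝ} (hR : 1 < R)
    (hf : DifferentiableOn ℂ f (ball 0 R)) : Continuous fun x : Sphere d => f x :=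
  hf.continuousOn.comp_continuous continuous_subtype_val fun x => by
    rw [mem_ball_zero_iff, sphere_norm]; exact hR

lemma swap_circle [NeZero d] {F : ℝ × Sphere d → ℂ} (hF : Continuous F) :
    (∫ t in (0 : ℝ)..2 * Real.pi, ∫ x, F (t, x) ∂sigma d) =
      ∫ x, (∫ t in (0 : ℝ)..2 * Real.pi, F (t, x)) ∂sigma d := by
  refine intervalIntegral_integral_swap (f := fun t x => F (t, x)) ?_
  have hK : IsCompact (uIcc (0 : ℝ) (2 * Real.pi) ×ˢ (univ : Set (Sphere d))) :=
    isCompact_uIcc.prod isCompact_univ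
  obtain ⟨C, hC⟩ := hK.exists_bound_of_continuousOn hF.continuousOn
  have : IsFiniteMeasure ((volume : Measure ℝ).restrict (uIoc 0 (2 * Real.pi))) :=
    ⟨by simp [uIoc]⟩
  refine Integrable.of_bound (C := C) hF.aestronglyMeasurable ?_
  have : ∀ᵐ p ∂((volume.restrict (uIoc 0 (2 * Real.pi))).prod (sigma d)),
      p.1 ∈ uIoc 0 (2 * Real.pi) :=
    Measure.quasiMeasurePreserving_fst.ae (ae_restrict_mem measurableSet_uIoc)
  filter_upwards [this] with p hp
  exact hC p ⟨uIoc_subset_uIcc hp, mem_univ _⟩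

/-- Averaging a holomorphic function over the circles orthogonal to the slice of `u`. -/
lemma integral_slice [NeZero d] {f : Cn d → ℂ} {R : ℝ} (hR : 1 < R)
    (hf : DifferentiableOn ℂ f (ball 0 R)) {h : ℂ → ℂ}
    (u : Cn d) (hu : ‖u‖ = 1)
    (hh : Continuous fun x : Sphere d => h ⟪u, (x : Cn d)⟫_ℂ) :
    ∫ x : Sphere d, f x * h ⟪u, (x : Cn d)⟫_ℂ ∂sigma d =
      ∫ x : Sphere d, f (⟪u, (x : Cn d)⟫_ℂ • u) * h ⟪u, (x : Cn d)⟫_ℂ ∂sigma d := by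
  have huu : ⟪u, u⟫_ℂ = 1 := by rw [inner_self_eq_norm_sq_to_K, hu]; simp
  let G : ℂ → Sphere d → Cn d := fun l x =>
    ⟪u, (x : Cn d)⟫_ℂ • u + l • ((x : Cn d) - ⟪u, (x : Cn d)⟫_ℂ • u)
  have hGn : ∀ l x, ‖l‖ ≤ 1 → ‖G l x‖ ≤ 1 := by
    intro l x hl
    have h0 : ⟪u, (x : Cn d) - ⟪u, (x : Cn d)⟫_ℂ • u⟫_ℂ = 0 := by
      rw [inner_sub_right, inner_smul_right, huu]; ring
    have h1 := norm_add_sq_eq_norm_sq_add_norm_sq_of_inner_eq_zero (𝕜 := ℂ)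
      (⟪u, (x : Cn d)⟫_ℂ • u) (l • ((x : Cn d) - ⟪u, (x : Cn d)⟫_ℂ • u))
      (by rw [inner_smul_left, inner_smul_right, h0]; simp)
    have h2 := norm_add_sq_eq_norm_sq_add_norm_sq_of_inner_eq_zero (𝕜 := ℂ)
      (⟪u, (x : Cn d)⟫_ℂ • u) ((x : Cn d) - ⟪u, (x : Cn d)⟫_ℂ • u)
      (by rw [inner_smul_left, h0]; simp)
    rw [add_sub_cancel, sphere_norm] at h2
    rw [norm_smul l] at h1
    have h3 : ‖l‖ * ‖l‖ ≤ 1 := by nlinarith [norm_nonneg l]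
    have h4 := mul_self_nonneg ‖(x : Cn d) - ⟪u, (x : Cn d)⟫_ℂ • u‖
    have h5 : ‖G l x‖ * ‖G l x‖ ≤ 1 := by
      refine h1.le.trans ?_
      nlinarith
    nlinarith [norm_nonneg (G l x)]
  have hGb : ∀ l x, ‖l‖ ≤ 1 → G l x ∈ ball (0 : Cn d) R := fun l x hl => by
    rw [mem_ball_zero_iff]; exact (hGn l x hl).trans_lt hR
  have hrot : ∀ l : ℂ, ‖l‖ = 1 → ∫ x : Sphere d, f x * h ⟪u, (x : Cn d)⟫_ℂ ∂sigma d =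
      ∫ x : Sphere d, f (G l x) * h ⟪u, (x : Cn d)⟫_ℂ ∂sigma d := by
    intro l hl
    obtain ⟨T, hT⟩ := exists_twist u hu 1 l (by simp) hl
    rw [← integral_sphere_comp T (fun y => f y * h ⟪u, y⟫_ℂ)]
    refine integral_congr_ae (ae_of_all _ fun x => ?_)
    have h1 : T x = G l x := by rw [hT, one_mul]
    have h2 : ⟪u, T x⟫_ℂ = ⟪u, (x : Cn d)⟫_ℂ := by
      rw [hT]
      simp only [inner_add_right, inner_smul_right, inner_sub_right, huu]; ring
    simp only [h2]; rw [h1]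
  have hmean : ∀ x : Sphere d, f (⟪u, (x : Cn d)⟫_ℂ • u) =
      (2 * Real.pi)⁻¹ • ∫ t in (0 : ℝ)..2 * Real.pi, f (G (circleMap 0 1 t) x) := by
    intro x
    have hd : DiffContOnCl ℂ (fun l => f (G l x)) (ball 0 |1|) := by
      rw [abs_one]
      refine DifferentiableOn.diffContOnCl (hf.comp ?_ ?_)
      · exact Differentiable.differentiableOn (by simp only [G]; fun_prop)
      · intro l hl
        rw [closure_ball _ one_ne_zero, mem_closedBall_zero_iff] at hl
        exact hGb l x hl
    have := hd.circleAverage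
    rw [Real.circleAverage_def] at this
    rw [this]; simp [G]
  have hcm : ∀ t, ‖circleMap 0 1 t‖ = 1 := fun t => by simp
  have hjoint : Continuous fun p : ℝ × Sphere d =>
      f (G (circleMap 0 1 p.1) p.2) * h ⟪u, (p.2 : Cn d)⟫_ℂ := by
    refine Continuous.mul ?_ (hh.comp continuous_snd)
    refine hf.continuousOn.comp_continuous ?_ fun p => hGb _ _ (hcm _).le
    have hcc : Continuous fun p : ℝ × Sphere d => circleMap 0 1 p.1 :=
      (continuous_circleMap 0 1).comp continuous_fst
    simp only [G]
    fun_prop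
  have hswap := swap_circle hjoint
  have e1 : ∀ I : ℂ, I = (2 * Real.pi)⁻¹ • ∫ _t in (0 : ℝ)..2 * Real.pi, I := fun I => by
    rw [intervalIntegral.integral_const, sub_zero, inv_smul_smul₀ Real.two_pi_pos.ne']
  rw [e1 (∫ x : Sphere d, f x * h ⟪u, (x : Cn d)⟫_ℂ ∂sigma d),
    intervalIntegral.integral_congr (fun t _ => hrot _ (hcm t)), hswap, ← integral_smul]
  refine integral_congr_ae (ae_of_all _ fun x => ?_)
  simp only [hmean x, intervalIntegral.integral_mul_const, smul_mul_assoc]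

/-- The moments of a slice variable. -/
def sliceMoment (d : ℕ) (u : Cn d) (n : ℕ) : ℂ :=
  ∫ x : Sphere d, ⟪u, (x : Cn d)⟫_ℂ ^ n * conj ⟪u, (x : Cn d)⟫_ℂ ^ n ∂sigma d

lemma integral_pow_mul_conj_pow_of_ne (u : Cn d) (hu : ‖u‖ = 1) {m n : ℕ} (hmn : m ≠ n) :
    ∫ x : Sphere d, ⟪u, (x : Cn d)⟫_ℂ ^ m * conj ⟪u, (x : Cn d)⟫_ℂ ^ n ∂sigma d = 0 := by
  have huu : ⟪u, u⟫_ℂ = 1 := by rw [inner_self_eq_norm_sq_to_K, hu]; simp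
  have hne : ((m : ℂ) - n) ≠ 0 := sub_ne_zero.2 (by exact_mod_cast hmn)
  set t : ℝ := Real.pi / ((m : ℝ) - n) with ht
  set α : ℂ := Complex.exp (t * Complex.I) with hα
  have hαn : ‖α‖ = 1 := Complex.norm_exp_ofReal_mul_I t
  have hprod : α ^ m * conj α ^ n = -1 := by
    rw [hα, ← Complex.exp_conj, ← Complex.exp_nat_mul, ← Complex.exp_nat_mul, ← Complex.exp_add,
      ← Complex.exp_pi_mul_I]
    congr 1
    simp only [map_mul, Complex.conj_ofReal, Complex.conj_I, ht]
    push_cast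
    field_simp
    ring
  obtain ⟨T, hT⟩ := exists_twist u hu α 1 hαn (by simp)
  have h2 : ∀ x : Cn d, ⟪u, T x⟫_ℂ = α * ⟪u, x⟫_ℂ := fun x => by
    rw [hT]
    simp only [inner_add_right, inner_smul_right, inner_sub_right, huu]; ring
  have key := integral_sphere_comp T (fun y => ⟪u, y⟫_ℂ ^ m * conj ⟪u, y⟫_ℂ ^ n)
  have : ∀ x : Cn d, ⟪u, T x⟫_ℂ ^ m * conj ⟪u, T x⟫_ℂ ^ n =
      -1 * (⟪u, x⟫_ℂ ^ m * conj ⟪u, x⟫_ℂ ^ n) := fun x => by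
    rw [h2, map_mul, mul_pow, mul_pow, ← hprod]; ring
  simp only [this, integral_const_mul] at key
  linear_combination (-1 / 2 : ℂ) * key

/-- Pairing of a homogeneous holomorphic function with a power of a linear form. -/
lemma integral_homogeneous [NeZero d] {p : Cn d → ℂ} (hp : Differentiable ℂ p) {n : ℕ}
    (hom : ∀ (c : ℂ) z, p (c • z) = c ^ n * p z) (u : Cn d) (hu : ‖u‖ = 1) :
    ∫ x : Sphere d, p x * conj ⟪u, (x : Cn d)⟫_ℂ ^ n ∂sigma d = sliceMoment d u n * p u := by
  rw [integral_slice (h := fun s => conj s ^ n) one_lt_two hp.differentiableOn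
    u hu (by fun_prop), sliceMoment, ← integral_mul_const]
  refine integral_congr_ae (ae_of_all _ fun x => ?_)
  simp only [hom]; ring

lemma sliceMoment_eq [NeZero d] (u v : Cn d) (hu : ‖u‖ = 1) (hv : ‖v‖ = 1) (huv : ⟪u, v⟫_ℂ ≠ 0)
    (n : ℕ) : sliceMoment d u n = sliceMoment d v n := by
  have h1 := integral_homogeneous (p := fun z => ⟪u, z⟫_ℂ ^ n) (n := n)
    ((innerSL ℂ u).differentiable.pow n) (fun c z => by rw [inner_smul_right, mul_pow]) v hv
  have h2 := integral_homogeneous (p := fun z => ⟪v, z⟫_ℂ ^ n) (n := n)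
    ((innerSL ℂ v).differentiable.pow n) (fun c z => by rw [inner_smul_right, mul_pow]) u hu
  have h3 : conj (sliceMoment d v n) = sliceMoment d v n := by
    rw [sliceMoment, ← integral_conj]
    refine integral_congr_ae (ae_of_all _ fun x => ?_)
    simp only [map_mul, map_pow, Complex.conj_conj]; ring
  have h4 := congrArg conj h1
  rw [← integral_conj, map_mul, h3] at h4
  simp only [map_mul, map_pow, inner_conj_symm] at h4 h2
  have h5 : sliceMoment d u n * ⟪v, u⟫_ℂ ^ n = sliceMoment d v n * ⟪v, u⟫_ℂ ^ n := by
    rw [← h2, ← h4]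
    refine integral_congr_ae (ae_of_all _ fun x => ?_)
    ring
  refine mul_right_cancel₀ (pow_ne_zero n ?_) h5
  exact fun h => huv (inner_eq_zero_symm.1 h)


lemma sliceMoment_zero [NeZero d] (u : Cn d) : sliceMoment d u 0 = 1 := by
  simp [sliceMoment]

lemma hasDerivAt_aux [NeZero d] (u : Cn d) (hu : ‖u‖ = 1) (n : ℕ) (j : Fin d) :
    HasDerivAt (fun t : ℂ => ∫ x : Sphere d, (x : Cn d) j * ⟪u, (x : Cn d)⟫_ℂ ^ n *
        (conj ⟪u, (x : Cn d)⟫_ℂ + t * conj ((x : Cn d) j)) ^ (n + 1) ∂sigma d)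
      (∫ x : Sphere d, (x : Cn d) j * ⟪u, (x : Cn d)⟫_ℂ ^ n * (((n + 1 : ℕ) : ℂ) *
        (conj ⟪u, (x : Cn d)⟫_ℂ + 0 * conj ((x : Cn d) j)) ^ n * conj ((x : Cn d) j)) ∂sigma d)
      0 := by
  have hc : ∀ t : ℂ, Continuous fun x : Sphere d => (x : Cn d) j * ⟪u, (x : Cn d)⟫_ℂ ^ n *
        (conj ⟪u, (x : Cn d)⟫_ℂ + t * conj ((x : Cn d) j)) ^ (n + 1) := fun t => by fun_prop
  have hb1 : ∀ x : Sphere d, ‖⟪u, (x : Cn d)⟫_ℂ‖ ≤ 1 := fun x => by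
    simpa [hu] using norm_inner_le_norm (𝕜 := ℂ) u (x : Cn d)
  have hb2 : ∀ x : Sphere d, ‖(x : Cn d) j‖ ≤ 1 := fun x =>
    (PiLp.norm_apply_le (x : Cn d) j).trans (sphere_norm x).le
  refine (hasDerivAt_integral_of_dominated_loc_of_deriv_le (s := ball (0 : ℂ) 1)
    (bound := fun _ => ((n + 1 : ℕ) : ℝ) * 2 ^ n)
    (F' := fun t (x : Sphere d) => (x : Cn d) j * ⟪u, (x : Cn d)⟫_ℂ ^ n * (((n + 1 : ℕ) : ℂ) *
        (conj ⟪u, (x : Cn d)⟫_ℂ + t * conj ((x : Cn d) j)) ^ n * conj ((x : Cn d) j)))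
    (ball_mem_nhds _ one_pos) (Eventually.of_forall fun t => (hc t).aestronglyMeasurable)
    (integrable_sphere (hc 0)) (Continuous.aestronglyMeasurable (by fun_prop))
    (ae_of_all _ fun x t ht => ?_) (integrable_const _) (ae_of_all _ fun x t ht => ?_)).2
  · have ht' : ‖t‖ ≤ 1 := (mem_ball_zero_iff.1 ht).le
    have h3 : ‖conj ⟪u, (x : Cn d)⟫_ℂ + t * conj ((x : Cn d) j)‖ ≤ 2 := by
      refine (norm_add_le _ _).trans ?_
      rw [norm_mul, RCLike.norm_conj, RCLike.norm_conj]
      nlinarith [hb1 x, hb2 x, norm_nonneg t, norm_nonneg ((x : Cn d) j)]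
    rw [norm_mul, norm_mul, norm_mul, norm_mul, norm_pow, norm_pow, RCLike.norm_conj,
      Complex.norm_natCast]
    calc _ ≤ 1 * 1 ^ n * (((n + 1 : ℕ) : ℝ) * 2 ^ n * 1) := by
          gcongr
          exacts [hb2 x, hb1 x, hb2 x]
      _ = _ := by ring
  · refine HasDerivAt.const_mul _ ?_
    have h1 : HasDerivAt (fun t : ℂ => conj ⟪u, (x : Cn d)⟫_ℂ + t * conj ((x : Cn d) j))
        (conj ((x : Cn d) j)) t := by
      simpa using ((hasDerivAt_id t).mul_const (conj ((x : Cn d) j))).const_add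
        (conj ⟪u, (x : Cn d)⟫_ℂ)
    have h2 := h1.pow (n + 1)
    rw [Nat.add_sub_cancel] at h2
    exact h2

lemma coord_moment [NeZero d] (u : Cn d) (hu : ‖u‖ = 1) (n : ℕ) (j : Fin d) :
    ((n : ℂ) + 1) * ∫ x : Sphere d, ((x : Cn d) j * conj ((x : Cn d) j)) *
        (⟪u, (x : Cn d)⟫_ℂ ^ n * conj ⟪u, (x : Cn d)⟫_ℂ ^ n) ∂sigma d =
      sliceMoment d u (n + 1) * (1 + n * (u j * conj (u j))) := by
  have huu : ⟪u, u⟫_ℂ = 1 := by rw [inner_self_eq_norm_sq_to_K, hu]; simp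
  set e : Cn d := EuclideanSpace.single j 1 with he
  have hin1 : ∀ z : Cn d, ⟪e, z⟫_ℂ = z j := fun z => by simp [he, EuclideanSpace.inner_single_left]
  have hin2 : ∀ z : Cn d, ⟪z, e⟫_ℂ = conj (z j) := fun z => by
    rw [← inner_conj_symm, hin1]
  let p : Cn d → ℂ := fun z => z j * ⟪u, z⟫_ℂ ^ n
  have hp : Differentiable ℂ p := by
    have h1 : Differentiable ℂ fun z : Cn d => z j := by fun_prop
    exact h1.mul ((innerSL ℂ u).differentiable.pow n)
  have hhom : ∀ (c : ℂ) z, p (c • z) = c ^ (n + 1) * p z := fun c z => by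
    simp only [p, inner_smul_right, PiLp.smul_apply, smul_eq_mul]; ring
  have hne : ∀ᶠ t : ℂ in 𝓝 0, ⟪u, u + t • e⟫_ℂ ≠ 0 := by
    refine ContinuousAt.eventually_ne (Continuous.continuousAt (by fun_prop)) ?_
    rw [zero_smul, add_zero, huu]; exact one_ne_zero
  have hev : (fun t : ℂ => ∫ x : Sphere d, (x : Cn d) j * ⟪u, (x : Cn d)⟫_ℂ ^ n *
        (conj ⟪u, (x : Cn d)⟫_ℂ + t * conj ((x : Cn d) j)) ^ (n + 1) ∂sigma d) =ᶠ[𝓝 0]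
      fun t : ℂ => sliceMoment d u (n + 1) * ((u j + t) * (1 + t * conj (u j)) ^ n) := by
    filter_upwards [hne] with t ht
    set w : Cn d := u + t • e with hw
    have hw0 : w ≠ 0 := fun h => ht (by rw [h, inner_zero_right])
    set r : ℂ := (‖w‖ : ℂ) with hr
    have hr0 : r ≠ 0 := by simpa [hr] using hw0
    set v : Cn d := r⁻¹ • w with hv
    have hwv : w = r • v := by rw [hv, smul_smul, mul_inv_cancel₀ hr0, one_smul]
    have hvn : ‖v‖ = 1 := by
      rw [hv, norm_smul, norm_inv, hr, Complex.norm_real, norm_norm,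
        inv_mul_cancel₀ (norm_ne_zero_iff.2 hw0)]
    have huv : ⟪u, v⟫_ℂ ≠ 0 := by
      rw [hv, inner_smul_right]; exact mul_ne_zero (inv_ne_zero hr0) ht
    have hpw : p w = (u j + t) * (1 + t * conj (u j)) ^ n := by
      simp only [p, hw, inner_add_right, inner_smul_right, hin2, huu]
      simp [he]
    have hconj : ∀ x : Cn d, conj ⟪u, x⟫_ℂ + t * conj (x j) = r * conj ⟪v, x⟫_ℂ := fun x => by
      rw [inner_conj_symm, inner_conj_symm, ← hin2, ← inner_smul_right, ← inner_smul_right,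
        ← inner_add_right, ← hwv]
    have key := integral_homogeneous hp hhom v hvn
    rw [← sliceMoment_eq u v hu hvn huv] at key
    rw [← hpw, hwv, hhom, mul_left_comm, ← key, ← integral_const_mul]
    refine integral_congr_ae (ae_of_all _ fun x => ?_)
    simp only [hconj, p, mul_pow]; ring
  have hd1 := (hasDerivAt_aux u hu n j).congr_of_eventuallyEq hev.symm
  have hd2 : HasDerivAt (fun t : ℂ => sliceMoment d u (n + 1) *
      ((u j + t) * (1 + t * conj (u j)) ^ n))
      (sliceMoment d u (n + 1) * (1 + n * (u j * conj (u j)))) 0 := by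
    refine HasDerivAt.const_mul _ ?_
    have h1 : HasDerivAt (fun t : ℂ => u j + t) 1 0 := by
      simpa using (hasDerivAt_id (0 : ℂ)).const_add (u j)
    have h2 : HasDerivAt (fun t : ℂ => 1 + t * conj (u j)) (conj (u j)) 0 := by
      simpa using ((hasDerivAt_id (0 : ℂ)).mul_const (conj (u j))).const_add 1
    have h3 := h1.mul (h2.pow n)
    refine h3.congr_deriv ?_
    simp only [Pi.pow_apply, zero_mul, add_zero, one_pow]; ring
  rw [← hd1.unique hd2, ← integral_const_mul]
  refine integral_congr_ae (ae_of_all _ fun x => ?_)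
  push_cast
  simp only [zero_mul, add_zero]; ring

/-- The norms of the powers of a slice variable. -/
lemma sliceMoment_succ [NeZero d] (u : Cn d) (hu : ‖u‖ = 1) (n : ℕ) :
    ((n : ℂ) + 1) * sliceMoment d u n = sliceMoment d u (n + 1) * (d + n) := by
  have hsum : ∀ z : Cn d, ‖z‖ = 1 → ∑ j, z j * conj (z j) = 1 := fun z hz => by
    have := EuclideanSpace.norm_sq_eq z
    simp only [Complex.mul_conj, Complex.normSq_eq_norm_sq]
    rw [hz] at this
    rw [one_pow] at this
    exact_mod_cast this.symm
  have h := Finset.sum_congr rfl (fun j (_ : j ∈ Finset.univ) => coord_moment u hu n j)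
  rw [← Finset.mul_sum, ← integral_finsetSum, ← Finset.mul_sum, Finset.sum_add_distrib,
    ← Finset.mul_sum, hsum u hu] at h
  · simp only [← Finset.sum_mul, hsum _ (sphere_norm _), one_mul] at h
    simpa [sliceMoment] using h
  · intro j _
    exact integrable_sphere (by fun_prop)

lemma sliceMoment_mul_choose [NeZero d] (u : Cn d) (hu : ‖u‖ = 1) (n : ℕ) :
    ((n + (d - 1)).choose (d - 1) : ℂ) * sliceMoment d u n = 1 := by
  obtain ⟨k, rfl⟩ : ∃ k, d = k + 1 := ⟨d - 1, by have := NeZero.one_le (n := d); omega⟩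
  simp only [Nat.add_sub_cancel]
  induction n with
  | zero => simp [sliceMoment_zero]
  | succ n ih =>
    have h1 := sliceMoment_succ u hu n
    have h2 : ((n + 1 + k).choose k : ℂ) * (n + 1) = ((n + k).choose k : ℂ) * (n + k + 1) := by
      have := Nat.add_one_mul_choose_eq (n + k) n
      have e1 : (n + k).choose n = (n + k).choose k := Nat.choose_symm_add
      have e2 : (n + k + 1).choose (n + 1) = (n + 1 + k).choose k := by
        rw [show n + k + 1 = n + 1 + k by ring]; exact Nat.choose_symm_add
      rw [e1, e2] at this
      have := congrArg (Nat.cast : ℕ → ℂ) this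
      push_cast at this
      linear_combination -this
    have h3 : ((n : ℂ) + 1) ≠ 0 := by exact_mod_cast Nat.succ_ne_zero n
    refine mul_left_cancel₀ h3 ?_
    push_cast at h1
    rw [mul_one]
    linear_combination sliceMoment (k + 1) u (n + 1) * h2 - ((n + k).choose k : ℂ) * h1 +
      ((n : ℂ) + 1) * ih

/-- Cauchy's formula in one slice. -/
lemma integral_slice_cauchy [NeZero d] {F : ℂ → ℂ} {R : ℝ} (hR : 1 < R)
    (hF : DifferentiableOn ℂ F (ball 0 R)) (u : Cn d) (hu : ‖u‖ = 1) (ρ : ℂ) (hρ : ‖ρ‖ < 1) :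
    ∫ x : Sphere d, F ⟪u, (x : Cn d)⟫_ℂ * (1 / (1 - ρ * conj ⟪u, (x : Cn d)⟫_ℂ) ^ d) ∂sigma d
      = F ρ := by
  have hX : ∀ x : Sphere d, ‖⟪u, (x : Cn d)⟫_ℂ‖ ≤ 1 := fun x => by
    simpa [hu] using norm_inner_le_norm (𝕜 := ℂ) u (x : Cn d)
  set a : ℕ → ℂ := fun n => (n.factorial : ℂ)⁻¹ * iteratedDeriv n F 0 with ha
  have hT : ∀ z : ℂ, ‖z‖ < R → HasSum (fun n => a n * z ^ n) (F z) := fun z hz => by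
    have := Complex.hasSum_taylorSeries_on_ball hF (z := z) (by simpa using hz)
    simp only [sub_zero, smul_eq_mul] at this
    have h2 : (fun n => a n * z ^ n) =
        fun n => (n.factorial : ℂ)⁻¹ * (z ^ n * iteratedDeriv n F 0) := by
      funext n; simp only [ha]; ring
    rw [h2]; exact this
  have hsa : Summable fun n => ‖a n‖ := by
    have := (hT 1 (by simpa using hR)).summable.norm
    simpa using this
  have hcoef : ∀ n, ∫ x : Sphere d, F ⟪u, (x : Cn d)⟫_ℂ * conj ⟪u, (x : Cn d)⟫_ℂ ^ n ∂sigma d =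
      a n * sliceMoment d u n := fun n => by
    have hs := hasSum_integral_of_summable_integral_norm (μ := sigma d)
      (F := fun m (x : Sphere d) => a m * (⟪u, (x : Cn d)⟫_ℂ ^ m * conj ⟪u, (x : Cn d)⟫_ℂ ^ n))
      (fun m => integrable_sphere (by fun_prop)) (by
        refine Summable.of_nonneg_of_le (fun m => integral_nonneg fun x => norm_nonneg _)
          (fun m => ?_) hsa
        refine (integral_mono_of_nonneg (g := fun _ => ‖a m‖) (ae_of_all _ fun x => norm_nonneg _)
          (integrable_const _) (ae_of_all _ fun x => ?_)).trans (by simp)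
        simp only [norm_mul, norm_pow, RCLike.norm_conj]
        calc _ ≤ ‖a m‖ * (1 ^ m * 1 ^ n) := by gcongr <;> exact hX x
          _ = _ := by simp)
    have hs2 := hs.unique (hasSum_single n fun m hm => by
      rw [integral_const_mul, integral_pow_mul_conj_pow_of_ne u hu hm, mul_zero])
    rw [integral_const_mul] at hs2
    rw [sliceMoment, ← hs2]
    refine integral_congr_ae (ae_of_all _ fun x => ?_)
    have h1 := (hT _ ((hX x).trans_lt hR)).mul_right (conj ⟪u, (x : Cn d)⟫_ℂ ^ n)
    simp only [← h1.tsum_eq, mul_assoc]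
  have hcont : Continuous fun x : Sphere d => F ⟪u, (x : Cn d)⟫_ℂ :=
    hF.continuousOn.comp_continuous (by fun_prop) fun x => by
      rw [mem_ball_zero_iff]; exact (hX x).trans_lt hR
  obtain ⟨M, hM⟩ := isCompact_univ.exists_bound_of_continuousOn hcont.continuousOn
  have hd : d - 1 + 1 = d := Nat.succ_pred (NeZero.ne d)
  have hgeo : ∀ z : ℂ, ‖z‖ < 1 →
      HasSum (fun n => ((n + (d - 1)).choose (d - 1) : ℂ) * z ^ n) (1 / (1 - z) ^ d) := fun z hz => by
    have := hasSum_choose_mul_geometric_of_norm_lt_one (d - 1) hz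
    rwa [hd] at this
  have hgs := (hgeo ρ hρ).summable.norm
  have hs := hasSum_integral_of_summable_integral_norm (μ := sigma d)
      (F := fun n (x : Sphere d) => (((n + (d - 1)).choose (d - 1) : ℂ) * ρ ^ n) *
        (F ⟪u, (x : Cn d)⟫_ℂ * conj ⟪u, (x : Cn d)⟫_ℂ ^ n))
      (fun n => integrable_sphere
        (continuous_const.mul (hcont.mul (by fun_prop)))) (by
        refine Summable.of_nonneg_of_le (fun m => integral_nonneg fun x => norm_nonneg _)
          (fun n => ?_) (hgs.mul_right M)
        refine (integral_mono_of_nonneg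
          (g := fun _ => ‖((n + (d - 1)).choose (d - 1) : ℂ) * ρ ^ n‖ * M)
          (ae_of_all _ fun x => norm_nonneg _)
          (integrable_const _) (ae_of_all _ fun x => ?_)).trans (by simp)
        simp only [norm_mul _ (F _ * _)]
        gcongr
        rw [norm_mul, norm_pow, RCLike.norm_conj]
        calc _ ≤ M * 1 ^ n := by
              gcongr
              exacts [(norm_nonneg _).trans (hM x (mem_univ _)), hM x (mem_univ _), hX x]
          _ = _ := by simp)
  have hρR := hT ρ (hρ.trans hR)
  have hterm : ∀ n, ∫ x : Sphere d, (((n + (d - 1)).choose (d - 1) : ℂ) * ρ ^ n) *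
        (F ⟪u, (x : Cn d)⟫_ℂ * conj ⟪u, (x : Cn d)⟫_ℂ ^ n) ∂sigma d = a n * ρ ^ n := fun n => by
    rw [integral_const_mul, hcoef]
    linear_combination a n * ρ ^ n * sliceMoment_mul_choose u hu n
  simp only [hterm] at hs
  rw [hρR.unique hs]
  refine integral_congr_ae (ae_of_all _ fun x => ?_)
  have hn : ‖ρ * conj ⟪u, (x : Cn d)⟫_ℂ‖ < 1 := by
    rw [norm_mul, RCLike.norm_conj]
    nlinarith [hX x, norm_nonneg ρ, norm_nonneg ⟪u, (x : Cn d)⟫_ℂ]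
  simp only
  rw [← (hgeo _ hn).tsum_eq, ← tsum_mul_left]
  refine tsum_congr fun n => ?_
  rw [mul_pow]; ring

/-- Cauchy's formula for the ball. -/
lemma cauchy_ball [NeZero d] {f : Cn d → ℂ} {R : ℝ} (hR : 1 < R)
    (hf : DifferentiableOn ℂ f (ball 0 R)) (w : Cn d) (hw : ‖w‖ < 1) :
    ∫ x : Sphere d, f x * (1 / (1 - ⟪(x : Cn d), w⟫_ℂ) ^ d) ∂sigma d = f w := by
  obtain ⟨u, hu, huw⟩ : ∃ u : Cn d, ‖u‖ = 1 ∧ w = (‖w‖ : ℂ) • u := by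
    by_cases h : w = 0
    · exact ⟨EuclideanSpace.single 0 1, by simp, by simp [h]⟩
    · refine ⟨(‖w‖ : ℂ)⁻¹ • w, ?_, ?_⟩
      · rw [norm_smul, norm_inv, Complex.norm_real, norm_norm,
          inv_mul_cancel₀ (norm_ne_zero_iff.2 h)]
      · rw [smul_smul, mul_inv_cancel₀ (by simpa using h), one_smul]
  set ρ : ℂ := (‖w‖ : ℂ) with hρd
  have hρ : ‖ρ‖ < 1 := by simpa [hρd] using hw
  have hker : ∀ x : Cn d, ⟪x, w⟫_ℂ = ρ * conj ⟪u, x⟫_ℂ := fun x => by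
    rw [huw, inner_smul_right, inner_conj_symm]
  have hX : ∀ x : Sphere d, ‖⟪u, (x : Cn d)⟫_ℂ‖ ≤ 1 := fun x => by
    simpa [hu] using norm_inner_le_norm (𝕜 := ℂ) u (x : Cn d)
  have hne : ∀ x : Sphere d, (1 - ρ * conj ⟪u, (x : Cn d)⟫_ℂ) ^ d ≠ 0 := fun x => by
    refine pow_ne_zero _ (sub_ne_zero.2 fun h => ?_)
    have h2 := congrArg norm h
    rw [norm_mul, RCLike.norm_conj, norm_one] at h2
    nlinarith [hX x, norm_nonneg ρ, norm_nonneg ⟪u, (x : Cn d)⟫_ℂ]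
  have hsl := integral_slice (f := f) (h := fun s => 1 / (1 - ρ * conj s) ^ d) hR hf u hu
    (continuous_const.div (by fun_prop) hne)
  have hF : DifferentiableOn ℂ (fun s : ℂ => f (s • u)) (ball 0 R) := by
    refine hf.comp (Differentiable.differentiableOn (by fun_prop)) fun s hs => ?_
    rw [mem_ball_zero_iff] at hs ⊢
    rwa [norm_smul, hu, mul_one]
  have hc := integral_slice_cauchy hR hF u hu ρ hρ
  simp only [hker]
  rw [hsl, hc, ← huw]

/-- The kernel functions `z ↦ (1 - ⟨z, w⟩)⁻ᵈ`. -/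
def szego (d : ℕ) (w z : Cn d) : ℂ := 1 / (1 - ⟪w, z⟫_ℂ) ^ d

lemma differentiableOn_szego (w : Cn d) (hw : ‖w‖ < 1) :
    ∃ R, 1 < R ∧ DifferentiableOn ℂ (szego d w) (ball 0 R) := by
  obtain ⟨s, hs1, hs2⟩ := exists_between hw
  have hs0 : 0 < s := (norm_nonneg _).trans_lt hs1
  refine ⟨s⁻¹, (one_lt_inv₀ hs0).2 hs2, ?_⟩
  have h1 : Differentiable ℂ fun z : Cn d => (1 - ⟪w, z⟫_ℂ) ^ d :=
    ((differentiable_const 1).sub (innerSL ℂ w).differentiable).pow d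
  have he : szego d w = fun z : Cn d => ((1 - ⟪w, z⟫_ℂ) ^ d)⁻¹ := by
    funext z; simp [szego]
  rw [he]
  refine DifferentiableOn.fun_inv h1.differentiableOn fun z hz => ?_
  refine pow_ne_zero _ (sub_ne_zero.2 fun h => ?_)
  have h2 := norm_inner_le_norm (𝕜 := ℂ) w z
  rw [← h, norm_one] at h2
  rw [mem_ball_zero_iff] at hz
  have h3 : ‖w‖ * ‖z‖ ≤ s * ‖z‖ := by gcongr
  have h4 : s * ‖z‖ < s * s⁻¹ := by gcongr
  rw [mul_inv_cancel₀ hs0.ne'] at h4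
  linarith

lemma conj_szego (w z : Cn d) : conj (szego d w z) = 1 / (1 - ⟪z, w⟫_ℂ) ^ d := by
  simp [szego]

/-- Positivity of the kernel for a function holomorphic beyond the closed ball. -/
lemma kernel_pos_aux [NeZero d] {g : Cn d → ℂ} {R : ℝ} (hR : 1 < R)
    (hg : DifferentiableOn ℂ g (ball 0 R)) (hg1 : ∀ x : Sphere d, ‖g x‖ ≤ 1)
    (s : Finset (Ball d)) (a : Ball d → ℂ) :
    0 ≤ (∑ j ∈ s, ∑ i ∈ s, conj (a i) * a j *
      ((1 - g i * conj (g j)) * szego d (j : Cn d) (i : Cn d))).re := by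
  have hlt : ∀ j : Ball d, ‖(j : Cn d)‖ < 1 := fun j => mem_ball_zero_iff.1 j.2
  obtain ⟨r, hr1, hrR, hr⟩ : ∃ r, 1 < r ∧ r ≤ R ∧
      ∀ j ∈ s, DifferentiableOn ℂ (szego d (j : Cn d)) (ball 0 r) := by
    classical
    induction s using Finset.induction_on with
    | empty => exact ⟨R, hR, le_rfl, by simp⟩
    | insert j s hj ih =>
      obtain ⟨r, h1, h2, h3⟩ := ih
      obtain ⟨r', h1', h2'⟩ := differentiableOn_szego (j : Cn d) (hlt j)
      refine ⟨min r r', lt_min h1 h1', (min_le_left _ _).trans h2, fun i hi => ?_⟩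
      rcases Finset.mem_insert.1 hi with rfl | hi
      · exact h2'.mono (ball_subset_ball (min_le_right _ _))
      · exact (h3 i hi).mono (ball_subset_ball (min_le_left _ _))
  have hg' : DifferentiableOn ℂ g (ball 0 r) := hg.mono (ball_subset_ball hrR)
  let H : Cn d → ℂ := fun z => ∑ j ∈ s, a j * szego d (j : Cn d) z
  let T : Cn d → ℂ := fun z => ∑ j ∈ s, a j * conj (g j) * szego d (j : Cn d) z
  have hH : DifferentiableOn ℂ H (ball 0 r) :=
    DifferentiableOn.fun_sum fun j hj => (differentiableOn_const _).mul (hr j hj)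
  have hT : DifferentiableOn ℂ T (ball 0 r) :=
    DifferentiableOn.fun_sum fun j hj => (differentiableOn_const _).mul (hr j hj)
  -- pairing with a combination of kernels
  have hpair : ∀ (f : Cn d → ℂ), DifferentiableOn ℂ f (ball 0 r) → ∀ c : Ball d → ℂ,
      ∫ x : Sphere d, f x * conj (∑ j ∈ s, c j * szego d (j : Cn d) x) ∂sigma d =
        ∑ j ∈ s, conj (c j) * f j := by
    intro f hf c
    have h1 : ∀ x : Sphere d, f x * conj (∑ j ∈ s, c j * szego d (j : Cn d) x) =
        ∑ j ∈ s, conj (c j) * (f x * (1 / (1 - ⟪(x : Cn d), (j : Cn d)⟫_ℂ) ^ d)) := fun x => by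
      rw [map_sum, Finset.mul_sum]
      refine Finset.sum_congr rfl fun j _ => ?_
      rw [map_mul, conj_szego]; ring
    simp only [h1]
    rw [integral_finsetSum]
    · refine Finset.sum_congr rfl fun j _ => ?_
      rw [integral_const_mul, cauchy_ball hr1 hf _ (hlt j)]
    · intro j hj
      refine (integrable_sphere ((continuous_sphere hr1 hf).mul ?_)).const_mul _
      have := continuous_star.comp (continuous_sphere hr1 (hr j hj))
      refine this.congr fun x => ?_
      exact conj_szego _ _
  have cg := continuous_sphere hr1 hg'
  have cH := continuous_sphere hr1 hH
  have cT := continuous_sphere hr1 hT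
  have iH := hpair H hH a
  have iT := hpair T hT (fun j => a j * conj (g j))
  have iX := hpair (fun z => g z * T z) (hg'.mul hT) a
  have hTX : ∑ j ∈ s, conj (a j * conj (g j)) * T j = ∑ j ∈ s, conj (a j) * (g j * T j) :=
    Finset.sum_congr rfl fun j _ => by rw [map_mul, Complex.conj_conj]; ring
  have hgoal : ∑ j ∈ s, ∑ i ∈ s, conj (a i) * a j *
      ((1 - g i * conj (g j)) * szego d (j : Cn d) (i : Cn d)) =
      (∫ x : Sphere d, H x * conj (H x) ∂sigma d) -
        ∫ x : Sphere d, T x * conj (T x) ∂sigma d := by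
    rw [iH, iT, Finset.sum_comm, ← Finset.sum_sub_distrib]
    refine Finset.sum_congr rfl fun i _ => ?_
    simp only [H, T]
    rw [Finset.mul_sum, Finset.mul_sum, ← Finset.sum_sub_distrib]
    refine Finset.sum_congr rfl fun j _ => ?_
    rw [map_mul, Complex.conj_conj]; ring
  have hsq : ∀ f : Cn d → ℂ, (Continuous fun x : Sphere d => f x) →
      (∫ x : Sphere d, f x * conj (f x) ∂sigma d).re = ∫ x : Sphere d, ‖f x‖ ^ 2 ∂sigma d := by
    intro f _
    simp only [Complex.mul_conj, Complex.normSq_eq_norm_sq]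
    exact (congrArg Complex.re (integral_ofReal (𝕜 := ℂ))).trans (Complex.ofReal_re _)
  have int2 : ∀ f : Sphere d → ℂ, Continuous f → Integrable (fun x => ‖f x‖ ^ 2) (sigma d) := by
    intro f hf
    obtain ⟨C, hC⟩ := isCompact_univ.exists_bound_of_continuousOn
      (f := fun x => ‖f x‖ ^ 2) (by fun_prop)
    exact Integrable.of_bound (Continuous.aestronglyMeasurable (by fun_prop)) C
      (ae_of_all _ fun x => hC x (mem_univ _))
  have hcross : (∫ x : Sphere d, (g x * T x) * conj (H x) ∂sigma d) =
      ∫ x : Sphere d, T x * conj (T x) ∂sigma d := by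
    rw [iX, iT, hTX]
  have hre : ∫ x : Sphere d, ((g x * T x) * conj (H x)).re ∂sigma d =
      ∫ x : Sphere d, ‖T x‖ ^ 2 ∂sigma d := by
    rw [← hsq T cT, ← hcross]
    exact integral_re (integrable_sphere ((cg.mul cT).mul (continuous_star.comp cH)))
  have hpt : ∀ x : Sphere d, 2 * ((g x * T x) * conj (H x)).re ≤ ‖T x‖ ^ 2 + ‖H x‖ ^ 2 := by
    intro x
    have h1 : ((g x * T x) * conj (H x)).re ≤ ‖T x‖ * ‖H x‖ := by
      refine (Complex.re_le_norm _).trans ?_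
      rw [norm_mul, norm_mul, RCLike.norm_conj]
      gcongr
      exact mul_le_of_le_one_left (norm_nonneg _) (hg1 x)
    nlinarith [sq_nonneg (‖T x‖ - ‖H x‖)]
  have hint : ∫ x : Sphere d, 2 * ((g x * T x) * conj (H x)).re ∂sigma d ≤
      ∫ x : Sphere d, (‖T x‖ ^ 2 + ‖H x‖ ^ 2) ∂sigma d := integral_mono
    ((integrable_sphere ((cg.mul cT).mul (continuous_star.comp cH))).re.const_mul 2)
    ((int2 _ cT).add (int2 _ cH)) hpt
  rw [integral_const_mul, integral_add (int2 _ cT) (int2 _ cH), hre] at hint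
  rw [hgoal, Complex.sub_re, hsq H cH, hsq T cT]
  linarith

end SzegoPositivity

open Classical in
/-- Extension by zero of a function on the ball. -/
def extendZero {d : ℕ} (f : Ball d → ℂ) (z : Cn d) : ℂ :=
  if h : z ∈ ball (0 : Cn d) 1 then f ⟨z, h⟩ else 0

/-- `f ∈ Hol(B_d)`. -/
def IsHolomorphic {d : ℕ} (f : Ball d → ℂ) : Prop :=
  DifferentiableOn ℂ (extendZero f) (ball (0 : Cn d) 1)

/-- A holomorphic function from the unit ball `B_d` to the open unit disk. -/
structure SchurFunction (d : ℕ) where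
  toFun : Ball d → ℂ
  holomorphic : IsHolomorphic toFun
  norm_lt_one : ∀ z, ‖toFun z‖ < 1

instance {d : ℕ} : CoeFun (SchurFunction d) (fun _ => Ball d → ℂ) := ⟨SchurFunction.toFun⟩

/-- The kernel `k^b(z, w) = (1 - b(z) conj(b(w))) / (1 - ⟨z, w⟩)^d`, where
`⟨z, w⟩ = ∑ j, z_j conj(w_j)`, which is `⟪w, z⟫_ℂ` in the convention used here. -/
def kernelFun {d : ℕ} (b : SchurFunction d) (z w : Ball d) : ℂ :=
  (1 - b z * conj (b w)) / (1 - ⟪(w : Cn d), (z : Cn d)⟫_ℂ) ^ d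

/-- The same kernel, as an operator-valued matrix. -/
def kernelMatrix {d : ℕ} (b : SchurFunction d) : Matrix (Ball d) (Ball d) (ℂ →L[ℂ] ℂ) :=
  Matrix.of fun z w => kernelFun b z w • ContinuousLinearMap.id ℂ ℂ

lemma kernelFun_pos {d : ℕ} [NeZero d] (b : SchurFunction d) (s : Finset (Ball d))
    (a : Ball d → ℂ) :
    0 ≤ (∑ j ∈ s, ∑ i ∈ s, conj (a i) * a j * kernelFun b i j).re := by
  have hext : ∀ z : Ball d, extendZero b (z : Cn d) = b z := fun z => by
    simp only [extendZero]; rw [dif_pos z.2]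
  have hpos : ∀ r ∈ Ioo (0 : ℝ) 1, 0 ≤ (∑ j ∈ s, ∑ i ∈ s, conj (a i) * a j *
      ((1 - extendZero b (r • (i : Cn d)) * conj (extendZero b (r • (j : Cn d)))) *
        szego d (j : Cn d) (i : Cn d))).re := by
    intro r hr
    refine kernel_pos_aux (g := fun z => extendZero b (r • z)) (R := r⁻¹)
      ((one_lt_inv₀ hr.1).2 hr.2) ?_ ?_ s a
    · refine b.holomorphic.comp
        (Differentiable.differentiableOn (Differentiable.const_smul differentiable_id r))
        fun z hz => ?_
      rw [mem_ball_zero_iff] at hz ⊢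
      simp only [norm_smul, Real.norm_eq_abs, abs_of_pos hr.1]
      calc r * ‖z‖ < r * r⁻¹ := by have := hr.1; gcongr
        _ = 1 := mul_inv_cancel₀ hr.1.ne'
    · intro x
      simp only [extendZero]
      split_ifs with h
      · exact (b.norm_lt_one _).le
      · simp
  have hlim : ∀ z : Ball d, Tendsto (fun r : ℝ => extendZero b (r • (z : Cn d))) (𝓝[<] 1)
      (𝓝 (b z)) := by
    intro z
    have h1 : ContinuousAt (extendZero b) (z : Cn d) :=
      (b.holomorphic.differentiableAt (isOpen_ball.mem_nhds z.2)).continuousAt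
    have h2 : Tendsto (fun r : ℝ => r • (z : Cn d)) (𝓝[<] 1) (𝓝 (z : Cn d)) := by
      have : Tendsto (fun r : ℝ => r • (z : Cn d)) (𝓝 1) (𝓝 ((1 : ℝ) • (z : Cn d))) :=
        (Continuous.tendsto (by fun_prop) _)
      rw [one_smul] at this
      exact this.mono_left nhdsWithin_le_nhds
    rw [← hext z]
    exact h1.tendsto.comp h2
  have hT : Tendsto (fun r : ℝ => (∑ j ∈ s, ∑ i ∈ s, conj (a i) * a j *
      ((1 - extendZero b (r • (i : Cn d)) * conj (extendZero b (r • (j : Cn d)))) *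
        szego d (j : Cn d) (i : Cn d))).re) (𝓝[<] 1)
      (𝓝 (∑ j ∈ s, ∑ i ∈ s, conj (a i) * a j * ((1 - b i * conj (b j)) *
        szego d (j : Cn d) (i : Cn d))).re) := by
    refine (Complex.continuous_re.tendsto _).comp ?_
    refine tendsto_finsetSum _ fun j _ => tendsto_finsetSum _ fun i _ => ?_
    exact (((hlim i).mul ((Complex.continuous_conj.tendsto _).comp (hlim j))).const_sub 1
      |>.mul_const _).const_mul _
  have hfin := ge_of_tendsto hT (by
    filter_upwards [Ioo_mem_nhdsLT (zero_lt_one (α := ℝ))] with r hr using hpos r hr)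
  refine hfin.trans_eq (congrArg Complex.re ?_)
  refine Finset.sum_congr rfl fun j _ => Finset.sum_congr rfl fun i _ => ?_
  simp only [kernelFun, szego]; ring

instance {d : ℕ} [NeZero d] (b : SchurFunction d) : Fact (kernelMatrix b).PosSemidef := by
  have h := (RKHS.posSemidef_tfae (K := kernelMatrix b)).out 0 2
  refine ⟨h.2 ⟨?_, fun v => ?_⟩⟩
  · refine Matrix.IsHermitian.ext fun i j => ?_
    simp only [kernelMatrix, Matrix.of_apply]
    rw [star_smul]
    have h1 : star (ContinuousLinearMap.id ℂ ℂ) = ContinuousLinearMap.id ℂ ℂ :=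
      star_one (ℂ →L[ℂ] ℂ)
    rw [h1]
    congr 1
    simp only [kernelFun, Complex.star_def, map_div₀, map_sub, map_one, map_mul, map_pow,
      Complex.conj_conj, inner_conj_symm]
    ring
  · have := kernelFun_pos b v.support v
    refine this.trans_eq ?_
    simp only [Finsupp.sum]
    rw [← RCLike.conj_re, map_sum]
    refine congrArg Complex.re (Finset.sum_congr rfl fun j _ => ?_)
    rw [map_sum]
    refine Finset.sum_congr rfl fun i _ => ?_
    rw [inner_conj_symm]
    simp [kernelMatrix]
    ring

/-- The de Branges--Rovnyak space `𝓗(b)`: the reproducing kernel Hilbert space of functions on the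
ball with kernel `k^b`. -/
abbrev HSpace {d : ℕ} [NeZero d] (b : SchurFunction d) : Type :=
  RKHS.OfKernel (kernelMatrix b)

lemma kernel_HSpace {d : ℕ} [NeZero d] (b : SchurFunction d) (z w : Ball d) :
    RKHS.kernel (HSpace b) z w 1 = kernelFun b z w := by
  rw [RKHS.OfKernel.kernel_ofKernel]; simp [kernelMatrix]

/-- `f` has the radial limit `l = lim_{r → 1-} f(rζ)` at the point `ζ` of the sphere. -/
def HasRadialLimit {d : ℕ} (f : Ball d → ℂ) (ζ : Sphere d) (l : ℂ) : Prop :=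
  Tendsto (fun r : ℝ => extendZero f (r • (ζ : Cn d))) (𝓝[<] 1) (𝓝 l)

open Classical in
/-- The boundary value `f(ζ) = lim_{r → 1-} f(rζ)`, with the value `0` where there is no limit. -/
def boundaryValue {d : ℕ} (f : Ball d → ℂ) (ζ : Sphere d) : ℂ :=
  if h : ∃ l, HasRadialLimit f ζ l then h.choose else 0

/-- `|b(ζ)| = 1` for `σ`-almost all points `ζ` of the sphere. -/
def IsInner {d : ℕ} (b : SchurFunction d) : Prop :=
  ∀ᵐ ζ ∂sigma d, ‖boundaryValue b ζ‖ = 1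

/-- The restriction to the sphere of a measure on the closed ball. -/
def restrictSphere {d : ℕ} (μ : Measure (ClosedBall d)) : Measure (Sphere d) :=
  μ.comap (inclusion sphere_subset_closedBall)

/-- A holomorphic function is `μ`-admissible if it has radial limits `μ`-almost everywhere on the
sphere. -/
def IsAdmissible {d : ℕ} (μ : Measure (ClosedBall d)) (f : Ball d → ℂ) : Prop :=
  IsHolomorphic f ∧ ∀ᵐ ζ ∂restrictSphere μ, ∃ l, HasRadialLimit f ζ l

open Classical in
/-- The function on the closed ball given by `f` inside and by its boundary values on the sphere. -/
def toClosedBall {d : ℕ} (f : Ball d → ℂ) (z : ClosedBall d) : ℂ :=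
  if h : (z : Cn d) ∈ sphere (0 : Cn d) 1 then boundaryValue f ⟨z, h⟩ else extendZero f z

/-- `μ` is a reverse Carleson measure for `𝓗(b)`: `‖f‖_{𝓗(b)} ≤ C ‖f‖_{L²(μ)}` for all
`μ`-admissible functions `f` in `𝓗(b)`, where the right-hand side may be infinite. -/
def IsReverseCarleson {d : ℕ} [NeZero d] (μ : Measure (ClosedBall d)) (b : SchurFunction d) :
    Prop :=
  ∃ C : ℝ≥0, 0 < C ∧ ∀ f : HSpace b, IsAdmissible μ (f : Ball d → ℂ) →
    ‖f‖ₑ ≤ C * eLpNorm (toClosedBall (f : Ball d → ℂ)) 2 μ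

end DeBrangesRovnyak
end

open DeBrangesRovnyak

/-! The reverse Carleson inequality is tested on the kernels `kernelVec b w` with `w = rζ`. They are
`μ`-admissible because `b` is, and the squared norm of such a kernel is `(1 - |b(w)|²) / (1 -
|w|²)^d`. Multiplying by `(1 - |w|²)^d` turns the inequality into `1 - |b(w)|² ≤ C² ∫ P(w, z) |1 -
b(z) conj b(w)|² dμ(z)`, where `P` is the Poisson–Szegő kernel `poissonSzego`.

Now let `r → 1`. The part of `μ` inside the ball and the singular part on the sphere form
`singularRest μ`. Since `|1 - b(z) conj b(w)|² ≤ 4`, their contribution is at most four times a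
Poisson–Szegő integral, whose lower limit vanishes `σ`-a.e. (`ae_liminf_poissonSzego_eq_zero`). The
absolutely continuous part, with density `h`, is compared with its value at `ζ` by an approximate
identity argument in `L¹(σ)` (`tendsto_lintegral_oscillation`). This gives `1 - |b|² ≤ C² (1 -
|b|²)² h` almost everywhere on the sphere (`ae_one_sub_norm_sq_le`).

Both conclusions follow pointwise. If `h = 0` a.e., then `|b| = 1` a.e. and `b` is inner. Where `|b|
< 1`, one factor cancels, so `1 / (1 - |b|) ≤ 2 C² h`, which is integrable because `μ` is finite.

The radial limits of `b` exist `σ`-a.e. by Fatou's theorem, proved on the disk and carried to the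
ball by slicing. On the disk, a primitive of a bounded function is Lipschitz, hence differentiable
along almost every point of the circle, and a tangential derivative of the primitive forces a radial
limit of the function (`tendsto_deriv_of_isLittleO_circle`). -/

/-! ### Fatou's theorem on the unit disk. -/

/-- The derivative of a holomorphic function as an average of its values on the unit circle. The
kernel is symmetrized by a term of mean zero, which gives it a Poisson-type decay. -/
lemma deriv_eq_circleAverage_symm {H : ℂ → ℂ} (hH : DiffContOnCl ℂ H (ball 0 1))
    {w : ℂ} (hw : w ∈ ball (0 : ℂ) 1) :
    deriv H w = Real.circleAverage
      (fun z => z * (1 / (z - w) ^ 2 - 1 / (1 - conj w * z) ^ 2) * H z) 0 1 := by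
  have hwn : ‖w‖ < 1 := mem_ball_zero_iff.1 hw
  have hne1 : ∀ z ∈ sphere (0 : ℂ) 1, z - w ≠ 0 := fun z hz h => by
    rw [mem_sphere_zero_iff_norm, sub_eq_zero.1 h] at hz
    exact hwn.ne hz
  have hne2 : ∀ z ∈ closedBall (0 : ℂ) 1, 1 - conj w * z ≠ 0 := fun z hz h => by
    have h2 := congrArg norm (sub_eq_zero.1 h)
    rw [norm_mul, norm_one, RCLike.norm_conj] at h2
    rw [mem_closedBall_zero_iff] at hz
    nlinarith [norm_nonneg w, norm_nonneg z]
  have hcl : closure (ball (0 : ℂ) 1) = closedBall 0 1 := closure_ball _ one_ne_zero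
  have hHc : ContinuousOn H (closedBall 0 1) := hcl ▸ hH.continuousOn
  have hHs : ContinuousOn H (sphere 0 1) := hHc.mono sphere_subset_closedBall
  have hci : CircleIntegrable H 0 1 := hHs.circleIntegrable zero_le_one
  have hz2 : DiffContOnCl ℂ (fun z => z * (1 / (1 - conj w * z) ^ 2) * H z) (ball 0 1) := by
    refine DiffContOnCl.smul (c := fun z => z * (1 / (1 - conj w * z) ^ 2)) ?_ hH
    refine DifferentiableOn.diffContOnCl ?_
    rw [hcl]
    refine differentiableOn_id.mul (DifferentiableOn.div (by fun_prop) (by fun_prop) ?_)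
    exact fun z hz => pow_ne_zero _ (hne2 z hz)
  -- The integrand is holomorphic in `z` and vanishes at `0` thanks to the factor `z`, so its mean
  -- is zero.
  have havg2 : Real.circleAverage (fun z => z * (1 / (1 - conj w * z) ^ 2) * H z) 0 1 = 0 := by
    have h := DiffContOnCl.circleAverage (R := 1) (c := 0) (by rwa [abs_one])
      (f := fun z => z * (1 / (1 - conj w * z) ^ 2) * H z)
    simpa using h
  -- On the circle `(z + v) / (z - v) = 2z / (z - v) - 1`, so Cauchy's formula and the mean value
  -- property give the right-hand side. Differentiating both sides in `v` then yields the formula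
  -- for `deriv H w`.
  have hrep : ∀ v ∈ ball (0 : ℂ) 1,
      Real.circleAverage (fun z => herglotzRieszKernel 0 v z • H z) 0 1 = 2 * H v - H 0 := by
    intro v hv
    have hv1 := DiffContOnCl.circleAverage_smul_div (R := 1) (c := 0) (f := H)
      (by rwa [abs_one]) (w := v) (by rwa [abs_one])
    have hv0 := DiffContOnCl.circleAverage (R := 1) (c := 0) (f := H) (by rwa [abs_one])
    have hnv : ∀ z ∈ sphere (0 : ℂ) 1, z - v ≠ 0 := fun z hz h => by
      rw [mem_sphere_zero_iff_norm, sub_eq_zero.1 h] at hz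
      exact (mem_ball_zero_iff.1 hv).ne hz
    have hi1 : CircleIntegrable (fun z => ((z - 0) / (z - v)) • H z) 0 1 := by
      refine ContinuousOn.circleIntegrable zero_le_one (ContinuousOn.fun_smul ?_ hHs)
      exact ContinuousOn.div (by fun_prop) (by fun_prop) hnv
    have hi2 : CircleIntegrable (fun z => (2 : ℂ) • (((z - 0) / (z - v)) • H z)) 0 1 := by
      refine ContinuousOn.circleIntegrable zero_le_one
        (ContinuousOn.fun_const_smul (ContinuousOn.fun_smul ?_ hHs) _)
      exact ContinuousOn.div (by fun_prop) (by fun_prop) hnv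
    rw [← smul_eq_mul (2 : ℂ), ← hv1, ← hv0, ← Real.circleAverage_fun_smul,
      ← Real.circleAverage_fun_sub hi2 hci]
    refine Real.circleAverage_congr_sphere fun z hz => ?_
    rw [abs_one] at hz
    have := hnv z hz
    simp only [herglotzRieszKernel_def, smul_eq_mul, sub_zero]
    field_simp
    ring
  have hd1 := hasDerivAt_circleAverage_herglotzRieszKernel_smul hci hw
  have hd2 : HasDerivAt (fun v => 2 * H v - H 0) (2 * deriv H w) w :=
    (((hH.differentiableAt isOpen_ball hw).hasDerivAt).const_mul 2).sub_const _
  have hd3 := hd2.unique (hd1.congr_of_eventuallyEq (by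
    filter_upwards [isOpen_ball.mem_nhds hw] with v hv using (hrep v hv).symm))
  have hk : ContinuousOn (fun z => z * (1 / (z - w) ^ 2) * H z) (sphere 0 1) := by
    refine ContinuousOn.mul (continuousOn_id.mul (ContinuousOn.div (by fun_prop) (by fun_prop)
      fun z hz => pow_ne_zero _ (hne1 z hz))) hHs
  have h4 : Real.circleAverage (fun z => (2 * z / (z - w) ^ 2) • H z) 0 1 =
      2 * Real.circleAverage (fun z => z * (1 / (z - w) ^ 2) * H z) 0 1 := by
    rw [← smul_eq_mul (2 : ℂ), ← Real.circleAverage_fun_smul]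
    refine Real.circleAverage_congr_sphere fun z _ => ?_
    simp only [smul_eq_mul]
    ring
  rw [h4] at hd3
  have hsub := Real.circleAverage_fun_sub (hk.circleIntegrable zero_le_one)
    ((hz2.continuousOn.mono (hcl ▸ sphere_subset_closedBall)).circleIntegrable zero_le_one)
  rw [havg2, sub_zero] at hsub
  rw [mul_left_cancel₀ two_ne_zero hd3, ← hsub]
  refine Real.circleAverage_congr_sphere fun z _ => ?_
  ring

lemma Real.norm_circleAverage_le {f : ℂ → ℂ} {g : ℂ → ℝ} (hg : CircleIntegrable g 0 1)
    (h : ∀ z ∈ sphere (0 : ℂ) 1, ‖f z‖ ≤ g z) :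
    ‖Real.circleAverage f 0 1‖ ≤ Real.circleAverage g 0 1 := by
  rw [Real.circleAverage_def, Real.circleAverage_def, norm_smul, smul_eq_mul, Real.norm_eq_abs,
    abs_of_pos (inv_pos.2 Real.two_pi_pos)]
  refine mul_le_mul_of_nonneg_left ?_ (inv_pos.2 Real.two_pi_pos).le
  exact intervalIntegral.norm_integral_le_of_norm_le Real.two_pi_pos.le
    (ae_of_all _ fun t _ => h _ (by simp)) hg

/-- The Poisson integral of an affine function. -/
lemma circleAverage_poissonKernel_affine (A B : ℝ) {r : ℝ} (hr : r ∈ Ioo (0 : ℝ) 1) :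
    Real.circleAverage (fun z => poissonKernel 0 r z * (A + B * (2 - 2 * z.re))) 0 1 =
      A + B * (2 - 2 * r) := by
  have hrb : (r : ℂ) ∈ ball (0 : ℂ) 1 := by simp [abs_of_pos hr.1, hr.2]
  have hd : Differentiable ℂ fun z : ℂ => (A : ℂ) + B * (2 - 2 * z) := by fun_prop
  have hp := DiffContOnCl.circleAverage_poissonKernel_smul
    (hd.diffContOnCl (s := ball 0 1)) hrb
  have hne : ∀ z ∈ sphere (0 : ℂ) 1, ‖z - 0 - (r - 0)‖ ^ 2 ≠ 0 := fun z hz h => by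
    rw [sub_zero, sub_zero, sq_eq_zero_iff, norm_eq_zero, sub_eq_zero] at h
    rw [h] at hz
    exact (mem_ball_zero_iff.1 hrb).ne (mem_sphere_zero_iff_norm.1 hz)
  have hi : CircleIntegrable (poissonKernel 0 (r : ℂ) • fun z : ℂ => (A : ℂ) + B * (2 - 2 * z))
      0 1 := by
    refine ContinuousOn.circleIntegrable zero_le_one (ContinuousOn.smul ?_ (by fun_prop))
    exact ContinuousOn.div (by fun_prop) (by fun_prop) hne
  have h2 := Complex.reCLM.circleAverage_comp_comm hi
  rw [hp] at h2
  have h3 : (Complex.reCLM ((A : ℂ) + B * (2 - 2 * (r : ℂ))) : ℝ) = A + B * (2 - 2 * r) := by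
    simp
  rw [← h3, ← h2]
  refine Real.circleAverage_congr_sphere fun z _ => ?_
  simp [mul_add]

-- On the circle the symmetrized kernel at a real point `r` has size at most `2 (1 - r²) |z - 1| /
-- |z - r|⁴`. Since `|z - 1| ≤ 2 |z - r|`, integrating it against `ε |z - 1|` costs at most `8ε`
-- times a Poisson integral of `1`. The plain Cauchy kernel `1 / |z - r|²` would lose a logarithm
-- here.
open Asymptotics in
lemma tendsto_deriv_of_isLittleO_circle {H : ℂ → ℂ} (hH : DiffContOnCl ℂ H (ball 0 1))
    (ho : H =o[𝓝[sphere 0 1] 1] fun z => z - 1) :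
    Tendsto (fun r : ℝ => deriv H r) (𝓝[<] 1) (𝓝 0) := by
  have hcl : closure (ball (0 : ℂ) 1) = closedBall 0 1 := closure_ball _ one_ne_zero
  obtain ⟨M, hM⟩ := (isCompact_closedBall (0 : ℂ) 1).exists_bound_of_continuousOn
    (hcl ▸ hH.continuousOn)
  have hM0 : 0 ≤ M := (norm_nonneg _).trans (hM 0 (by simp))
  -- Far from `1` the bound `M` on `H` is absorbed by a power of `|z - 1|`. The cube is chosen
  -- because the kernel estimate turns it into a multiple of `|z - 1|² = 2 - 2 Re z`, a harmonic
  -- function whose Poisson integral at `r` is `2 - 2r`, which tends to `0`.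
  have hbound : ∀ ε > 0, ∃ K : ℝ, 0 ≤ K ∧ ∀ z ∈ sphere (0 : ℂ) 1,
      ‖H z‖ ≤ ε * ‖z - 1‖ + K * ‖z - 1‖ ^ 3 := by
    intro ε hε
    have h1 := ho.def hε
    rw [eventually_nhdsWithin_iff, Metric.eventually_nhds_iff] at h1
    obtain ⟨δ, hδ, h1⟩ := h1
    refine ⟨M / δ ^ 3, by positivity, fun z hz => ?_⟩
    rcases lt_or_ge ‖z - 1‖ δ with h | h
    · have := h1 (y := z) (by rwa [dist_eq_norm]) hz
      have : 0 ≤ M / δ ^ 3 * ‖z - 1‖ ^ 3 := by positivity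
      linarith
    · have h2 : M ≤ M / δ ^ 3 * ‖z - 1‖ ^ 3 := by
        rw [div_mul_eq_mul_div, le_div_iff₀ (by positivity)]
        gcongr
      have := hM z (sphere_subset_closedBall hz)
      have : 0 ≤ ε * ‖z - 1‖ := by positivity
      linarith
  have hmain : ∀ ε > 0, ∃ K : ℝ, ∀ r ∈ Ioo (0 : ℝ) 1,
      ‖deriv H r‖ ≤ 8 * ε + K * (2 - 2 * r) := by
    intro ε hε
    obtain ⟨K, hK0, hK⟩ := hbound ε hε
    refine ⟨8 * K, fun r hr => ?_⟩
    have hrb : (r : ℂ) ∈ ball (0 : ℂ) 1 := by simp [abs_of_pos hr.1, hr.2]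
    rw [deriv_eq_circleAverage_symm hH hrb, ← circleAverage_poissonKernel_affine _ _ hr]
    have hne : ∀ z ∈ sphere (0 : ℂ) 1, z - r ≠ 0 := fun z hz h => by
      rw [sub_eq_zero] at h
      rw [h] at hz
      exact (mem_ball_zero_iff.1 hrb).ne (mem_sphere_zero_iff_norm.1 hz)
    refine Real.norm_circleAverage_le ?_ fun z hz => ?_
    · refine ContinuousOn.circleIntegrable zero_le_one (ContinuousOn.mul ?_ (by fun_prop))
      refine ContinuousOn.div (by fun_prop) (by fun_prop) fun z hz => ?_
      rw [sub_zero, sub_zero]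
      exact pow_ne_zero _ (norm_ne_zero_iff.2 (hne z hz))
    · have hz1 : ‖z‖ = 1 := mem_sphere_zero_iff_norm.1 hz
      have hzc : z * conj z = 1 := by rw [Complex.mul_conj, Complex.normSq_eq_norm_sq, hz1]; simp
      have hzr := hne z hz
      have hflip : ‖1 - (r : ℂ) * z‖ = ‖z - r‖ := by
        have : 1 - (r : ℂ) * z = z * conj (z - r) := by
          rw [map_sub, Complex.conj_ofReal, mul_sub, hzc]; ring
        rw [this, norm_mul, hz1, one_mul, RCLike.norm_conj]
      have hzr2 : 1 - (r : ℂ) * z ≠ 0 := by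
        rw [← norm_ne_zero_iff, hflip]; exact norm_ne_zero_iff.2 hzr
      -- The numerator factors as a difference of squares: `(1 - rz)² - (z - r)² = (1 - r²)(1 - z)(1
      -- + z)`. The factor `1 - z` is the gain from the symmetrization.
      have hker : z * (1 / (z - r) ^ 2 - 1 / (1 - conj (r : ℂ) * z) ^ 2) =
          z * (((1 - r ^ 2 : ℝ) : ℂ) * (1 - z) * (1 + z) / ((z - r) ^ 2 * (1 - r * z) ^ 2)) := by
        rw [Complex.conj_ofReal, div_sub_div _ _ (pow_ne_zero 2 hzr) (pow_ne_zero 2 hzr2)]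
        congr 2
        push_cast
        ring
      set D := ‖z - (r : ℂ)‖ with hD
      have hD0 : 0 < D := norm_pos_iff.2 hzr
      have hr2 : 0 < 1 - r ^ 2 := by nlinarith [hr.1, hr.2]
      have h1z : ‖1 + z‖ ≤ 2 := by
        refine (norm_add_le _ _).trans ?_
        rw [norm_one, hz1]; norm_num
      have hs1 : ‖z - 1‖ ^ 2 = 2 - 2 * z.re := by
        have h5 : z.re ^ 2 + z.im ^ 2 = 1 := by
          have := Complex.normSq_eq_norm_sq z
          rw [hz1, Complex.normSq_apply] at this
          nlinarith
        rw [← Complex.normSq_eq_norm_sq, Complex.normSq_apply]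
        simp
        nlinarith
      have hs2 : ‖z - 1‖ ≤ 2 * D := by
        have h6 : 1 - r ≤ D := by
          have := norm_sub_norm_le z (r : ℂ)
          rwa [hz1, Complex.norm_real, Real.norm_eq_abs, abs_of_pos hr.1] at this
        have h7 : ‖z - 1‖ ≤ D + ‖(r : ℂ) - 1‖ := by
          have := norm_add_le (z - r) ((r : ℂ) - 1)
          rwa [sub_add_sub_cancel] at this
        have h8 : ‖(r : ℂ) - 1‖ = 1 - r := by
          rw [← norm_neg, neg_sub]
          have : (1 : ℂ) - r = ((1 - r : ℝ) : ℂ) := by push_cast; rfl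
          rw [this, Complex.norm_real, Real.norm_eq_abs, abs_of_pos (by linarith [hr.2])]
        linarith
      have hP : poissonKernel 0 r z = (1 - r ^ 2) / D ^ 2 := by
        rw [poissonKernel_def, sub_zero, sub_zero, hz1, Complex.norm_real, Real.norm_eq_abs,
          sq_abs, one_pow]
      rw [norm_mul, hker, norm_mul, hz1, one_mul, norm_div, norm_mul, norm_mul, norm_mul, norm_pow,
        norm_pow, hflip, ← hD, Complex.norm_real, Real.norm_eq_abs, abs_of_pos hr2,
        norm_sub_rev 1 z, hP, ← hs1]
      set s := ‖z - 1‖ with hs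
      have hs0 : 0 ≤ s := norm_nonneg _
      calc (1 - r ^ 2) * s * ‖1 + z‖ / (D ^ 2 * D ^ 2) * ‖H z‖
          ≤ (1 - r ^ 2) * s * 2 / (D ^ 2 * D ^ 2) * (ε * s + K * s ^ 3) := by
            gcongr; exact hK z hz
        _ = (1 - r ^ 2) / (D ^ 2 * D ^ 2) * (2 * (ε + K * s ^ 2)) * s ^ 2 := by ring
        _ ≤ (1 - r ^ 2) / (D ^ 2 * D ^ 2) * (2 * (ε + K * s ^ 2)) * (2 * D) ^ 2 := by gcongr
        _ = (1 - r ^ 2) / D ^ 2 * (8 * ε + 8 * K * s ^ 2) := by field_simp; ring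
  rw [Metric.tendsto_nhds]
  intro η hη
  -- With `ε = η / 16` the main term `8ε` is `η / 2`, leaving room for the vanishing term.
  obtain ⟨K, hK⟩ := hmain (η / 16) (by positivity)
  have hlim : Tendsto (fun r : ℝ => 8 * (η / 16) + K * (2 - 2 * r)) (𝓝[<] 1) (𝓝 (η / 2)) := by
    have : Tendsto (fun r : ℝ => 8 * (η / 16) + K * (2 - 2 * r)) (𝓝 1)
        (𝓝 (8 * (η / 16) + K * (2 - 2 * 1))) := Continuous.tendsto (by fun_prop) _
    convert this.mono_left nhdsWithin_le_nhds using 2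
    ring
  filter_upwards [hlim.eventually_lt_const (half_lt_self hη),
    Ioo_mem_nhdsLT (zero_lt_one (α := ℝ))] with r h1 h2
  rw [dist_zero_right]
  exact (hK r h2).trans_lt h1

-- Near `1` the circle is parametrized by `z = exp(i arg z)`, and `arg z = Im log z = O(z - 1)`.
-- This converts a derivative in the angle into an estimate in `z - 1`.
open Asymptotics in
lemma isLittleO_circle_of_hasDerivAt {H : ℂ → ℂ} (h1 : H 1 = 0)
    (hH : HasDerivAt (fun t : ℝ => H (Complex.exp (t * Complex.I))) 0 0) :
    H =o[𝓝[sphere 0 1] 1] fun z => z - 1 := by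
  have h2 := hH.isLittleO
  simp only [Complex.ofReal_zero, zero_mul, Complex.exp_zero, h1, sub_zero, smul_zero] at h2
  have harg : Tendsto Complex.arg (𝓝[sphere 0 1] 1) (𝓝 0) := by
    have := (Complex.continuousAt_arg Complex.one_mem_slitPlane).tendsto
    rw [Complex.arg_one] at this
    exact this.mono_left nhdsWithin_le_nhds
  have h3 := h2.comp_tendsto harg
  have hlog : (fun z : ℂ => z.arg) =O[𝓝[sphere 0 1] 1] fun z => z - 1 := by
    have h4 := (Complex.hasStrictDerivAt_log Complex.one_mem_slitPlane).hasDerivAt.isBigO_sub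
    simp only [Complex.log_one, sub_zero] at h4
    refine IsBigO.trans (g := Complex.log) (IsBigO.of_bound 1 (Eventually.of_forall fun z => ?_))
      (h4.mono nhdsWithin_le_nhds)
    rw [← Complex.log_im, Real.norm_eq_abs, one_mul]
    exact Complex.abs_im_le_norm _
  refine (h3.trans_isBigO hlog).congr' ?_ EventuallyEq.rfl
  filter_upwards [self_mem_nhdsWithin] with z hz
  rw [mem_sphere_zero_iff_norm] at hz
  have := Complex.norm_mul_exp_arg_mul_I z
  rw [hz, Complex.ofReal_one, one_mul] at this
  simp [this]

/-- Fatou's theorem: a bounded holomorphic function on the unit disk has radial limits almost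
everywhere. -/
theorem ae_exists_radial_limit_disk {f : ℂ → ℂ} (hf : DifferentiableOn ℂ f (ball 0 1))
    (hb : ∀ z ∈ ball (0 : ℂ) 1, ‖f z‖ ≤ 1) :
    ∀ᵐ t : ℝ, ∃ l, Tendsto (fun r : ℝ => f (r * Complex.exp (t * Complex.I))) (𝓝[<] 1) (𝓝 l) := by
  obtain ⟨G, hG⟩ := hf.isExactOn_ball
  have hGL : LipschitzOnWith 1 G (ball 0 1) :=
    (convex_ball 0 1).lipschitzOnWith_of_nnnorm_hasDerivWithin_le
      (fun z hz => (hG z hz).hasDerivWithinAt) fun z hz => by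
        rw [← NNReal.coe_le_coe]; exact hb z hz
  -- The Lipschitz extension supplies boundary values of the primitive, and Rademacher's theorem in
  -- one variable then applies to `g` along the circle.
  obtain ⟨g, hgL, hgG⟩ := hGL.extend_finite_dimension
  have hgd : ∀ z ∈ ball (0 : ℂ) 1, HasDerivAt g (f z) z := fun z hz =>
    (hG z hz).congr_of_eventuallyEq (by
      filter_upwards [isOpen_ball.mem_nhds hz] with w hw using (hgG hw).symm)
  have hexp : LipschitzWith 1 fun t : ℝ => Complex.exp (t * Complex.I) := by
    refine lipschitzWith_of_nnnorm_deriv_le (𝕜 := ℝ) (by fun_prop) fun t => ?_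
    have hd : HasDerivAt (fun t : ℝ => Complex.exp (t * Complex.I))
        (Complex.exp (t * Complex.I) * (1 * Complex.I)) t :=
      ((Complex.ofRealCLM.hasDerivAt (x := t)).mul_const Complex.I).cexp
    rw [hd.deriv, ← NNReal.coe_le_coe]
    simp
  filter_upwards [(hgL.comp hexp).ae_differentiableAt_real] with t ht
  set ζ := Complex.exp (t * Complex.I) with hζ
  have hζ1 : ‖ζ‖ = 1 := Complex.norm_exp_ofReal_mul_I t
  set a := deriv (g ∘ fun t : ℝ => Complex.exp (t * Complex.I)) t with ha
  -- Since `exp(is)` has derivative `i` at `0`, this choice makes the angular derivative of `H` at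
  -- `1` equal to `a - A i = 0`. Then `H'(r) = ζ f(rζ) - A` tends to `0`, so the radial limit of `f`
  -- is `A / ζ`.
  set A : ℂ := a / Complex.I with hA
  let H : ℂ → ℂ := fun z => g (ζ * z) - g ζ - A * (z - 1)
  have hHd : ∀ z ∈ ball (0 : ℂ) 1, HasDerivAt H (f (ζ * z) * ζ - A) z := by
    intro z hz
    have hz' : ζ * z ∈ ball (0 : ℂ) 1 := by
      rw [mem_ball_zero_iff, norm_mul, hζ1, one_mul]; exact mem_ball_zero_iff.1 hz
    have h1 : HasDerivAt (fun z => g (ζ * z)) (f (ζ * z) * (ζ * 1)) z :=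
      (hgd _ hz').comp z ((hasDerivAt_id z).const_mul ζ)
    have h2 : HasDerivAt (fun z : ℂ => A * (z - 1)) (A * 1) z :=
      ((hasDerivAt_id z).sub_const 1).const_mul A
    have h3 := (h1.sub_const (g ζ)).sub h2
    rw [mul_one, mul_one] at h3
    exact h3
  have hHc : DiffContOnCl ℂ H (ball 0 1) := by
    refine ⟨fun z hz => (hHd z hz).differentiableAt.differentiableWithinAt, ?_⟩
    have := hgL.continuous
    exact Continuous.continuousOn (by fun_prop)
  have ho := isLittleO_circle_of_hasDerivAt (H := H) (by simp [H]) (by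
    have h1 : HasDerivAt (fun s : ℝ => g (Complex.exp ((t + s : ℝ) * Complex.I))) a 0 := by
      have hh := ht.hasDerivAt
      rw [← add_zero t] at hh
      have := hh.scomp (h := fun s : ℝ => t + s) 0 ((hasDerivAt_id (0 : ℝ)).const_add t)
      simpa [ha, Function.comp_def] using this
    have h2 : HasDerivAt (fun s : ℝ => Complex.exp (s * Complex.I))
        (Complex.exp ((0 : ℝ) * Complex.I) * (1 * Complex.I)) 0 :=
      ((Complex.ofRealCLM.hasDerivAt (x := 0)).mul_const Complex.I).cexp
    have h3 := (h1.sub_const (g ζ)).sub ((h2.sub_const 1).const_mul A)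
    refine (h3.congr_deriv ?_).congr_of_eventuallyEq (Eventually.of_forall fun s => ?_)
    · rw [Complex.ofReal_zero, zero_mul, Complex.exp_zero, one_mul, one_mul, hA,
        div_mul_cancel₀ _ Complex.I_ne_zero, sub_self]
    · simp only [H, hζ, ← Complex.exp_add, Pi.sub_apply]
      push_cast
      rw [add_mul])
  have hlim := tendsto_deriv_of_isLittleO_circle hHc ho
  have hζ0 : ζ ≠ 0 := Complex.exp_ne_zero _
  refine ⟨A / ζ, ?_⟩
  have h5 : Tendsto (fun r : ℝ => (deriv H r + A) / ζ) (𝓝[<] 1) (𝓝 ((0 + A) / ζ)) :=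
    (hlim.add_const A).div_const ζ
  rw [zero_add] at h5
  refine h5.congr' ?_
  filter_upwards [Ioo_mem_nhdsLT (zero_lt_one (α := ℝ))] with r hr
  have hrb : (r : ℂ) ∈ ball (0 : ℂ) 1 := by simp [abs_of_pos hr.1, hr.2]
  rw [(hHd _ hrb).deriv, sub_add_cancel, mul_div_cancel_right₀ _ hζ0, mul_comm]

/-! ### Fatou's theorem on the ball and boundary values. -/

namespace DeBrangesRovnyak

lemma extendZero_coe {d : ℕ} (f : Ball d → ℂ) (z : Ball d) : extendZero f (z : Cn d) = f z := by
  simp only [extendZero]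
  rw [dif_pos z.2]

lemma norm_extendZero_le {d : ℕ} (b : SchurFunction d) (z : Cn d) : ‖extendZero b z‖ ≤ 1 := by
  simp only [extendZero]
  split_ifs with h
  · exact (b.norm_lt_one _).le
  · simp

lemma measurable_extendZero {d : ℕ} {f : Ball d → ℂ} (hf : IsHolomorphic f) :
    Measurable (extendZero f) := by
  classical
  have h : (ball (0 : Cn d) 1).piecewise (extendZero f) (fun _ => 0) = extendZero f := by
    funext z
    by_cases hz : z ∈ ball (0 : Cn d) 1
    · rw [piecewise_eq_of_mem _ _ _ hz]
    · rw [piecewise_eq_of_notMem _ _ _ hz, extendZero, dif_neg hz]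
  rw [← h]
  exact hf.continuousOn.measurable_piecewise continuousOn_const measurableSet_ball

lemma smul_mem_ball {d : ℕ} {r : ℝ} (hr : r ∈ Ioo (0 : ℝ) 1) {ζ : Cn d} (hζ : ‖ζ‖ = 1) :
    r • ζ ∈ ball (0 : Cn d) 1 := by
  rw [mem_ball_zero_iff, norm_smul, hζ, mul_one, Real.norm_eq_abs, abs_of_pos hr.1]
  exact hr.2

/-- If `φ r` were far from `l`, continuity would make `φ q` far from `l` for some nearby rational
`q`. This reduces radial limits to a countable family of radii, as measurability requires. -/
lemma tendsto_nhdsLT_of_rat {φ : ℝ → ℂ} (hφ : ContinuousOn φ (Ioo 0 1)) {l : ℂ}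
    (h : Tendsto (fun q : ℚ => φ q) (comap (fun q : ℚ => (q : ℝ)) (𝓝[<] 1)) (𝓝 l)) :
    Tendsto φ (𝓝[<] 1) (𝓝 l) := by
  rw [Metric.tendsto_nhds] at h ⊢
  intro ε hε
  have h1 := h (ε / 2) (by positivity)
  rw [eventually_comap] at h1
  obtain ⟨a, ha, h2⟩ := (mem_nhdsLT_iff_exists_Ioo_subset' (zero_lt_one (α := ℝ))).1
    (inter_mem h1 (Ioo_mem_nhdsLT (zero_lt_one (α := ℝ))))
  filter_upwards [Ioo_mem_nhdsLT ha] with r hr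
  by_contra hcon
  have hlt : ε / 2 < dist (φ r) l := by
    have := not_lt.1 hcon
    linarith
  have hca : ContinuousAt φ r := hφ.continuousAt (isOpen_Ioo.mem_nhds (h2 hr).2)
  have hev : ∀ᶠ s in 𝓝 r, ε / 2 < dist (φ s) l ∧ s ∈ Ioo a 1 :=
    ((hca.dist continuousAt_const).eventually_const_lt hlt).and (isOpen_Ioo.mem_nhds hr)
  obtain ⟨q, hq1, hq2⟩ := Rat.denseRange_cast.mem_nhds hev
  exact absurd ((h2 hq2).1 q rfl) (not_lt.2 hq1.le)

/-- The points of the sphere are allowed to depend on a parameter so that the set can live in the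
product of the sphere and the line, where Fubini is used. -/
lemma measurableSet_exists_radial_limit {d : ℕ} {f : Ball d → ℂ} (hf : IsHolomorphic f)
    {X : Type*} [MeasurableSpace X] {g : X → Cn d} (hg : Measurable g) (hg1 : ∀ x, ‖g x‖ = 1) :
    MeasurableSet {x | ∃ l, Tendsto (fun r : ℝ => extendZero f (r • g x)) (𝓝[<] 1) (𝓝 l)} := by
  have h := StronglyMeasurable.measurableSet_exists_tendsto
    (l := comap (fun q : ℚ => (q : ℝ)) (𝓝[<] 1))
    (f := fun (q : ℚ) (x : X) => extendZero f ((q : ℝ) • g x))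
    fun q => ((measurable_extendZero hf).comp (hg.const_smul (q : ℝ))).stronglyMeasurable
  convert h using 1
  ext x
  refine exists_congr fun l => ⟨fun h => h.comp tendsto_comap, fun h => ?_⟩
  refine tendsto_nhdsLT_of_rat (φ := fun r : ℝ => extendZero f (r • g x)) ?_ h
  exact hf.continuousOn.comp (Continuous.continuousOn (by fun_prop))
    fun r hr => smul_mem_ball hr (hg1 x)

/-- Fatou's theorem on the ball. -/
theorem ae_exists_hasRadialLimit {d : ℕ} [NeZero d] (b : SchurFunction d) :
    ∀ᵐ ζ ∂sigma d, ∃ l, HasRadialLimit b ζ l := by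
  -- The disk theorem gives the limit at `e^{it} ζ` for every `ζ` and almost every `t`. Exchanging
  -- the quantifiers fixes one `t` that works for almost every `ζ`, and the rotation by this
  -- `e^{it}` preserves `σ`.
  let p : Sphere d → ℝ → Prop := fun ζ t => ∃ l, Tendsto (fun r : ℝ =>
    extendZero b (r • (Complex.exp (t * Complex.I) • (ζ : Cn d)))) (𝓝[<] 1) (𝓝 l)
  have hmeas : MeasurableSet {x : Sphere d × ℝ | p x.1 x.2} := by
    refine measurableSet_exists_radial_limit b.holomorphic
      (g := fun x : Sphere d × ℝ => Complex.exp (x.2 * Complex.I) • (x.1 : Cn d))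
      (Continuous.measurable (by fun_prop)) fun x => ?_
    rw [norm_smul, Complex.norm_exp_ofReal_mul_I, one_mul, sphere_norm]
  have h1 : ∀ᵐ ζ ∂sigma d, ∀ᵐ t : ℝ, p ζ t := by
    refine ae_of_all _ fun ζ => ?_
    have hd : DifferentiableOn ℂ (fun z : ℂ => extendZero b (z • (ζ : Cn d))) (ball 0 1) := by
      refine b.holomorphic.comp (Differentiable.differentiableOn (by fun_prop)) fun z hz => ?_
      rw [mem_ball_zero_iff] at hz ⊢
      rwa [norm_smul, sphere_norm, mul_one]
    filter_upwards [ae_exists_radial_limit_disk hd fun z _ => norm_extendZero_le b _] with t ht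
    obtain ⟨l, hl⟩ := ht
    refine ⟨l, hl.congr fun r => ?_⟩
    rw [mul_smul, Complex.coe_smul]
  rw [Measure.ae_ae_comm hmeas] at h1
  obtain ⟨t, ht⟩ := h1.exists
  have hα : ‖Complex.exp (t * Complex.I)‖ = 1 := Complex.norm_exp_ofReal_mul_I t
  -- With the same scalar on the line and on its orthogonal complement, the twist is multiplication
  -- by that scalar. The choice of unit vector is immaterial.
  obtain ⟨T, hT⟩ := exists_twist (EuclideanSpace.single (0 : Fin d) (1 : ℂ)) (by simp) _ _ hα hα
  have hT2 : ∀ z, T z = Complex.exp (t * Complex.I) • z := fun z => by rw [hT]; module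
  have hmp := (measurePreserving_sphereMap T).symm
  filter_upwards [hmp.quasiMeasurePreserving.ae ht] with ζ hζ
  obtain ⟨l, hl⟩ := hζ
  refine ⟨l, ?_⟩
  rw [← hT2, ← sphereMap_coe, MeasurableEquiv.apply_symm_apply] at hl
  exact hl

lemma hasRadialLimit_boundaryValue {d : ℕ} {f : Ball d → ℂ} {ζ : Sphere d}
    (h : ∃ l, HasRadialLimit f ζ l) : HasRadialLimit f ζ (boundaryValue f ζ) := by
  rw [boundaryValue, dif_pos h]
  exact h.choose_spec

lemma boundaryValue_eq {d : ℕ} {f : Ball d → ℂ} {ζ : Sphere d} {l : ℂ}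
    (h : HasRadialLimit f ζ l) : boundaryValue f ζ = l :=
  tendsto_nhds_unique (hasRadialLimit_boundaryValue ⟨l, h⟩) h

lemma norm_boundaryValue_le {d : ℕ} (b : SchurFunction d) (ζ : Sphere d) :
    ‖boundaryValue b ζ‖ ≤ 1 := by
  by_cases h : ∃ l, HasRadialLimit b ζ l
  · exact le_of_tendsto (hasRadialLimit_boundaryValue h).norm
      (Eventually.of_forall fun r => norm_extendZero_le b _)
  · rw [boundaryValue, dif_neg h]
    simp

lemma aemeasurable_boundaryValue {d : ℕ} {f : Ball d → ℂ} (hf : IsHolomorphic f)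
    {ρ : Measure (Sphere d)} (h : ∀ᵐ ζ ∂ρ, ∃ l, HasRadialLimit f ζ l) :
    AEMeasurable (boundaryValue f) ρ := by
  refine aemeasurable_of_tendsto_metrizable_ae (𝓝[<] (1 : ℝ))
    (f := fun (r : ℝ) (ζ : Sphere d) => extendZero f (r • (ζ : Cn d)))
    (fun r => ((measurable_extendZero hf).comp
      (measurable_subtype_coe.const_smul r)).aemeasurable) ?_
  filter_upwards [h] with ζ hζ using hasRadialLimit_boundaryValue hζ

end DeBrangesRovnyak

/-! ### The Poisson–Szegő kernel as an approximate identity in `L¹(σ)`. -/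

noncomputable section
namespace DeBrangesRovnyak
open scoped ENNReal
variable {d : ℕ}

/-- The Poisson--Szegő kernel of the ball. -/
def poissonSzego (w z : Cn d) : ℝ := (1 - ‖w‖ ^ 2) ^ d / ‖1 - ⟪w, z⟫_ℂ‖ ^ (2 * d)

lemma poissonSzego_nonneg {w : Cn d} (hw : ‖w‖ ≤ 1) (z : Cn d) : 0 ≤ poissonSzego w z := by
  have : 0 ≤ 1 - ‖w‖ ^ 2 := by nlinarith [norm_nonneg w]
  exact div_nonneg (pow_nonneg this _) (by positivity)

lemma measurable_poissonSzego {X : Type*} [MeasurableSpace X] {f g : X → Cn d}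
    (hf : Measurable f) (hg : Measurable g) :
    Measurable fun x => ENNReal.ofReal (poissonSzego (f x) (g x)) := by
  simp only [poissonSzego]
  have h : Measurable fun x => ⟪f x, g x⟫_ℂ := hf.inner hg
  exact (((hf.norm.pow_const 2).const_sub 1).pow_const d |>.div
    ((h.const_sub 1).norm.pow_const (2 * d))).ennreal_ofReal

lemma norm_one_sub_inner_pos {w z : Cn d} (hw : ‖w‖ < 1) (hz : ‖z‖ ≤ 1) :
    0 < ‖1 - ⟪w, z⟫_ℂ‖ := by
  rw [norm_pos_iff]
  intro h
  have h2 := norm_inner_le_norm (𝕜 := ℂ) w z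
  rw [← sub_eq_zero.1 h, norm_one] at h2
  nlinarith [norm_nonneg w, norm_nonneg z]

/-- Cauchy's formula applied to `szego d w` itself and evaluated at `w`: the integrand becomes
`|szego d w|²`. -/
lemma integral_szego_sq [NeZero d] {w : Cn d} (hw : ‖w‖ < 1) :
    ∫ x : Sphere d, 1 / ‖1 - ⟪w, (x : Cn d)⟫_ℂ‖ ^ (2 * d) ∂sigma d = 1 / (1 - ‖w‖ ^ 2) ^ d := by
  obtain ⟨R, hR, hs⟩ := differentiableOn_szego w hw
  have h := cauchy_ball hR hs w hw
  have h1 : ∀ x : Sphere d, szego d w x * (1 / (1 - ⟪(x : Cn d), w⟫_ℂ) ^ d) =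
      ((1 / ‖1 - ⟪w, (x : Cn d)⟫_ℂ‖ ^ (2 * d) : ℝ) : ℂ) := by
    intro x
    rw [← conj_szego, Complex.mul_conj, Complex.normSq_eq_norm_sq, szego, norm_div, norm_one,
      norm_pow, div_pow, one_pow, ← pow_mul, mul_comm d 2]
  have h2 : szego d w w = ((1 / (1 - ‖w‖ ^ 2) ^ d : ℝ) : ℂ) := by
    rw [szego, inner_self_eq_norm_sq_to_K]
    push_cast
    rfl
  simp only [h1] at h
  rw [h2] at h
  exact Complex.ofReal_injective ((integral_ofReal (𝕜 := ℂ) (μ := sigma d)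
    (f := fun x : Sphere d => 1 / ‖1 - ⟪w, (x : Cn d)⟫_ℂ‖ ^ (2 * d))).symm.trans h)

lemma lintegral_szego_sq [NeZero d] {w : Cn d} (hw : ‖w‖ < 1) :
    ∫⁻ x : Sphere d, ENNReal.ofReal (1 / ‖1 - ⟪w, (x : Cn d)⟫_ℂ‖ ^ (2 * d)) ∂sigma d =
      ENNReal.ofReal (1 / (1 - ‖w‖ ^ 2) ^ d) := by
  rw [← integral_szego_sq hw, ofReal_integral_eq_lintegral_ofReal]
  · have hc : Continuous fun x : Sphere d => 1 / ‖1 - ⟪w, (x : Cn d)⟫_ℂ‖ ^ (2 * d) :=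
      Continuous.div (by fun_prop) (by fun_prop) fun x =>
        pow_ne_zero _ (norm_one_sub_inner_pos hw (sphere_norm x).le).ne'
    obtain ⟨C, hC⟩ := isCompact_univ.exists_bound_of_continuousOn hc.continuousOn
    exact Integrable.of_bound hc.aestronglyMeasurable C (ae_of_all _ fun x => hC x (mem_univ _))
  · exact ae_of_all _ fun x => by positivity

lemma norm_smul_sphere {r : ℝ} (hr : r ∈ Ioo (0 : ℝ) 1) (ζ : Sphere d) :
    ‖r • (ζ : Cn d)‖ = r := by
  rw [norm_smul, sphere_norm, mul_one, Real.norm_eq_abs, abs_of_pos hr.1]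

lemma lintegral_poissonSzego_right [NeZero d] {w : Cn d} (hw : ‖w‖ < 1) :
    ∫⁻ x : Sphere d, ENNReal.ofReal (poissonSzego w x) ∂sigma d = 1 := by
  have h0 : 0 < 1 - ‖w‖ ^ 2 := by nlinarith [norm_nonneg w]
  have h1 : ∀ x : Sphere d, ENNReal.ofReal (poissonSzego w x) =
      ENNReal.ofReal ((1 - ‖w‖ ^ 2) ^ d) *
        ENNReal.ofReal (1 / ‖1 - ⟪w, (x : Cn d)⟫_ℂ‖ ^ (2 * d)) := fun x => by
    rw [← ENNReal.ofReal_mul (by positivity), mul_one_div, poissonSzego]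
  simp only [h1]
  rw [lintegral_const_mul' _ _ ENNReal.ofReal_ne_top, lintegral_szego_sq hw,
    ← ENNReal.ofReal_mul (by positivity), mul_one_div_cancel (by positivity), ENNReal.ofReal_one]

/-- By `|1 - ⟨rζ, z⟩| = |1 - ⟨rz, ζ⟩|` the integral equals `((1 - r²) / (1 - r²|z|²))^d`. Together
with Fubini this bounds the `L¹(σ)` norm of a Poisson–Szegő integral, for measures on the closed
ball as well as on the sphere. -/
lemma lintegral_poissonSzego_left_le [NeZero d] {z : Cn d} (hz : ‖z‖ ≤ 1) {r : ℝ}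
    (hr : r ∈ Ioo (0 : ℝ) 1) :
    ∫⁻ ζ : Sphere d, ENNReal.ofReal (poissonSzego (r • (ζ : Cn d)) z) ∂sigma d ≤ 1 := by
  have hrz : ‖r • z‖ = r * ‖z‖ := by
    rw [norm_smul, Real.norm_eq_abs, abs_of_pos hr.1]
  have hrz1 : ‖r • z‖ ≤ r := by rw [hrz]; nlinarith [hr.1]
  have h0 : 0 < 1 - r ^ 2 := by nlinarith [hr.1, hr.2]
  have h2 : 1 - r ^ 2 ≤ 1 - ‖r • z‖ ^ 2 := by gcongr
  have h1 : ∀ ζ : Sphere d, ENNReal.ofReal (poissonSzego (r • (ζ : Cn d)) z) =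
      ENNReal.ofReal ((1 - r ^ 2) ^ d) *
        ENNReal.ofReal (1 / ‖1 - ⟪r • z, (ζ : Cn d)⟫_ℂ‖ ^ (2 * d)) := fun ζ => by
    have h3 : ‖1 - ⟪r • (ζ : Cn d), z⟫_ℂ‖ = ‖1 - ⟪r • z, (ζ : Cn d)⟫_ℂ‖ := by
      rw [← RCLike.norm_conj, map_sub, map_one, inner_conj_symm, ← Complex.coe_smul,
        ← Complex.coe_smul, inner_smul_right, inner_smul_left, Complex.conj_ofReal]
    rw [← ENNReal.ofReal_mul (by positivity), mul_one_div, poissonSzego, h3,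
      norm_smul_sphere hr]
  simp only [h1]
  rw [lintegral_const_mul' _ _ ENNReal.ofReal_ne_top, lintegral_szego_sq (hrz1.trans_lt hr.2),
    ← ENNReal.ofReal_mul (by positivity), mul_one_div]
  refine ENNReal.ofReal_le_one.2 (div_le_one_of_le₀ ?_ ?_)
  · gcongr
  · exact pow_nonneg (h0.le.trans h2) _

/-- Away from the point `ζ`, the kernel tends to zero. -/
lemma poissonSzego_le {r : ℝ} (hr : r ∈ Ioo (0 : ℝ) 1) (ζ : Sphere d) {z : Cn d} (hz : ‖z‖ ≤ 1)
    {δ : ℝ} (hδ : 0 < δ) (hdist : δ ≤ ‖z - ζ‖) :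
    poissonSzego (r • (ζ : Cn d)) z ≤ (1 - r ^ 2) ^ d / (r * δ ^ 2 / 2) ^ (2 * d) := by
  have h0 : 0 < 1 - r ^ 2 := by nlinarith [hr.1, hr.2]
  have hr0 := hr.1
  rw [poissonSzego, norm_smul_sphere hr]
  -- From `|z - ζ| ≥ δ` and `|z| ≤ 1` the polarization identity gives `Re ⟨ζ, z⟩ ≤ 1 - δ²/2`. Hence
  -- the real part of `1 - ⟨rζ, z⟩` is at least `1 - r + rδ²/2`.
  have key : r * δ ^ 2 / 2 ≤ ‖1 - ⟪r • (ζ : Cn d), z⟫_ℂ‖ := by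
    have h1 : ‖z - ζ‖ ^ 2 = ‖z‖ ^ 2 - 2 * (⟪z, (ζ : Cn d)⟫_ℂ).re + ‖(ζ : Cn d)‖ ^ 2 :=
      norm_sub_sq (𝕜 := ℂ) z (ζ : Cn d)
    have h2 : (⟪z, (ζ : Cn d)⟫_ℂ).re = (⟪(ζ : Cn d), z⟫_ℂ).re := inner_re_symm (𝕜 := ℂ) _ _
    have h3 : (1 - ⟪r • (ζ : Cn d), z⟫_ℂ).re = 1 - r * (⟪(ζ : Cn d), z⟫_ℂ).re := by
      rw [← Complex.coe_smul, inner_smul_left, Complex.conj_ofReal, Complex.sub_re, Complex.one_re,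
        Complex.re_ofReal_mul]
    have h4 := (le_abs_self _).trans (Complex.abs_re_le_norm (1 - ⟪r • (ζ : Cn d), z⟫_ℂ))
    rw [h3] at h4
    rw [sphere_norm, h2] at h1
    have h5 : δ ^ 2 ≤ ‖z - ζ‖ ^ 2 := by gcongr
    have h6 : ‖z‖ ^ 2 ≤ 1 := by nlinarith [norm_nonneg z]
    have h7 : (⟪(ζ : Cn d), z⟫_ℂ).re ≤ 1 - δ ^ 2 / 2 := by linarith
    have h8 := mul_le_mul_of_nonneg_left h7 hr.1.le
    linarith [hr.2]
  gcongr

lemma tendsto_poissonSzego_bound [NeZero d] {δ : ℝ} (hδ : 0 < δ) :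
    Tendsto (fun r : ℝ => ENNReal.ofReal ((1 - r ^ 2) ^ d / (r * δ ^ 2 / 2) ^ (2 * d)))
      (𝓝[<] 1) (𝓝 0) := by
  have h : ContinuousAt (fun r : ℝ => (1 - r ^ 2) ^ d / (r * δ ^ 2 / 2) ^ (2 * d)) 1 :=
    ContinuousAt.div (by fun_prop) (by fun_prop) (by positivity)
  have h2 := ENNReal.tendsto_ofReal (h.tendsto.mono_left (nhdsWithin_le_nhds (s := Iio 1)))
  simpa [NeZero.ne d] using h2

lemma norm_lt_one_smul {r : ℝ} (hr : r ∈ Ioo (0 : ℝ) 1) (ζ : Sphere d) :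
    ‖r • (ζ : Cn d)‖ < 1 := by
  rw [norm_smul_sphere hr]; exact hr.2

lemma measurable_poissonSzego_prod (r : ℝ) : Measurable fun p : Sphere d × Sphere d =>
    ENNReal.ofReal (poissonSzego (r • (p.1 : Cn d)) p.2) :=
  measurable_poissonSzego ((measurable_subtype_coe.comp measurable_fst).const_smul r)
    (measurable_subtype_coe.comp measurable_snd)

lemma measurable_poissonSzego_right (w : Cn d) : Measurable fun z : Sphere d =>
    ENNReal.ofReal (poissonSzego w z) :=
  measurable_poissonSzego measurable_const measurable_subtype_coe

lemma measurable_poissonSzego_left (r : ℝ) (z : Cn d) : Measurable fun ζ : Sphere d =>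
    ENNReal.ofReal (poissonSzego (r • (ζ : Cn d)) z) :=
  measurable_poissonSzego (measurable_subtype_coe.const_smul r) measurable_const

/-- The mean oscillation of `g` with respect to the Poisson--Szegő kernel. -/
def oscillation (g : Sphere d → ℂ) (r : ℝ) (ζ : Sphere d) : ℝ≥0∞ :=
  ∫⁻ z : Sphere d, ENNReal.ofReal (poissonSzego (r • (ζ : Cn d)) z) * ‖g z - g ζ‖ₑ ∂sigma d

lemma measurable_oscillation {g : Sphere d → ℂ} (hg : Measurable g) (r : ℝ) [NeZero d] :
    Measurable (oscillation g r) := by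
  refine Measurable.lintegral_prod_right' (f := fun p : Sphere d × Sphere d =>
    ENNReal.ofReal (poissonSzego (r • (p.1 : Cn d)) p.2) * ‖g p.2 - g p.1‖ₑ) ?_
  exact (measurable_poissonSzego_prod r).mul
    ((hg.comp measurable_snd).sub (hg.comp measurable_fst)).enorm

lemma tendsto_lintegral_oscillation_of_continuous [NeZero d] {g : Sphere d → ℂ}
    (hg : Continuous g) :
    Tendsto (fun r : ℝ => ∫⁻ ζ, oscillation g r ζ ∂sigma d) (𝓝[<] 1) (𝓝 0) := by
  rw [ENNReal.tendsto_nhds_zero]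
  intro ε hε
  obtain ⟨η, hη0, hη⟩ : ∃ η : ℝ, 0 < η ∧ ENNReal.ofReal η ≤ ε / 2 := by
    rcases eq_or_ne ε ⊤ with rfl | hT
    · exact ⟨1, one_pos, by simp [ENNReal.top_div]⟩
    · refine ⟨(ε / 2).toReal, ENNReal.toReal_pos (by simpa using hε.ne') ?_,
        ENNReal.ofReal_toReal_le⟩
      exact ENNReal.div_ne_top hT two_ne_zero
  have huc := CompactSpace.uniformContinuous_of_continuous hg
  obtain ⟨δ, hδ, hδ'⟩ := Metric.uniformContinuous_iff.1 huc η hη0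
  obtain ⟨M, hM⟩ := isCompact_univ.exists_bound_of_continuousOn hg.continuousOn
  have hlim := ENNReal.Tendsto.mul_const (tendsto_poissonSzego_bound (d := d) hδ)
    (b := ENNReal.ofReal (2 * M)) (Or.inr ENNReal.ofReal_ne_top)
  rw [zero_mul] at hlim
  have hε2 : (0 : ℝ≥0∞) < ε / 2 := ENNReal.half_pos hε.ne'
  filter_upwards [ENNReal.tendsto_nhds_zero.1 hlim _ hε2,
    Ioo_mem_nhdsLT (zero_lt_one (α := ℝ))] with r h1 hr
  set Q := ENNReal.ofReal ((1 - r ^ 2) ^ d / (r * δ ^ 2 / 2) ^ (2 * d)) with hQ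
  have hpt : ∀ ζ : Sphere d, oscillation g r ζ ≤ ε := by
    intro ζ
    -- For `z` within `δ` of `ζ`, uniform continuity makes the difference small. Otherwise the
    -- kernel is at most `Q`, which is small for `r` near `1`, and the difference is at most `2M`.
    have hle : ∀ z : Sphere d, ENNReal.ofReal (poissonSzego (r • (ζ : Cn d)) z) * ‖g z - g ζ‖ₑ ≤
        ENNReal.ofReal (poissonSzego (r • (ζ : Cn d)) z) * (ε / 2) +
          Q * ENNReal.ofReal (2 * M) := by
      intro z
      rcases lt_or_ge (dist z ζ) δ with h | h
      · refine le_add_right (mul_le_mul_right ?_ _)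
        rw [← ofReal_norm, ← dist_eq_norm]
        exact (ENNReal.ofReal_le_ofReal (hδ' h).le).trans hη
      · refine le_add_left (mul_le_mul' ?_ ?_)
        · refine ENNReal.ofReal_le_ofReal (poissonSzego_le hr ζ (sphere_norm z).le hδ ?_)
          rwa [Subtype.dist_eq, dist_eq_norm] at h
        · rw [← ofReal_norm]
          refine ENNReal.ofReal_le_ofReal ((norm_sub_le _ _).trans ?_)
          linarith [hM z (mem_univ _), hM ζ (mem_univ _)]
    refine (lintegral_mono hle).trans ?_
    rw [lintegral_add_right _ measurable_const, lintegral_const, measure_univ, mul_one,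
      lintegral_mul_const _ (measurable_poissonSzego_right _)]
    refine (add_le_add (mul_le_of_le_one_left' ?_) h1).trans (ENNReal.add_halves ε).le
    exact (lintegral_poissonSzego_right (norm_lt_one_smul hr ζ)).le
  exact (lintegral_mono hpt).trans (by simp)

/-- The Poisson--Szegő integrals are an approximate identity in `L¹(σ)`. -/
lemma tendsto_lintegral_oscillation [NeZero d] {g : Sphere d → ℂ} (hg : Measurable g)
    (hgi : Integrable g (sigma d)) :
    Tendsto (fun r : ℝ => ∫⁻ ζ, oscillation g r ζ ∂sigma d) (𝓝[<] 1) (𝓝 0) := by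
  rw [ENNReal.tendsto_nhds_zero]
  intro ε hε
  have hε3 : ε / 3 ≠ 0 := (ENNReal.div_pos hε.ne' (by simp)).ne'
  obtain ⟨g0, hg0, -⟩ := (memLp_one_iff_integrable.2 hgi).exists_boundedContinuous_eLpNorm_sub_le
    ENNReal.one_ne_top hε3
  rw [eLpNorm_one_eq_lintegral_enorm] at hg0
  have hm : Measurable fun z => ‖(g - g0) z‖ₑ := (hg.sub g0.continuous.measurable).enorm
  filter_upwards [ENNReal.tendsto_nhds_zero.1
    (tendsto_lintegral_oscillation_of_continuous g0.continuous) _ (pos_iff_ne_zero.2 hε3),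
    Ioo_mem_nhdsLT (zero_lt_one (α := ℝ))] with r h1 hr
  have hP := measurable_poissonSzego_prod (d := d) r
  -- The three-epsilon argument with a continuous `g0` close to `g` in `L¹`. The first term is an
  -- average of `|g - g0|`, and integrating in `ζ` does not increase its norm; the last uses that
  -- the kernel has mass one in `z`.
  have hle : ∀ ζ : Sphere d, oscillation g r ζ ≤
      (∫⁻ z : Sphere d, ENNReal.ofReal (poissonSzego (r • (ζ : Cn d)) z) * ‖(g - g0) z‖ₑ ∂sigma d) +
        oscillation g0 r ζ + ‖(g - g0) ζ‖ₑ := by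
    intro ζ
    have hPζ := measurable_poissonSzego_right (r • (ζ : Cn d))
    have e1 : ‖(g - g0) ζ‖ₑ = ∫⁻ z : Sphere d,
        ENNReal.ofReal (poissonSzego (r • (ζ : Cn d)) z) * ‖(g - g0) ζ‖ₑ ∂sigma d := by
      rw [lintegral_mul_const _ hPζ, lintegral_poissonSzego_right (norm_lt_one_smul hr ζ), one_mul]
    rw [e1, oscillation, oscillation, ← lintegral_add_left (hPζ.fun_mul hm),
      ← lintegral_add_right _ (hPζ.mul_const _)]
    refine lintegral_mono fun z => ?_
    simp only [Pi.sub_apply]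
    rw [← mul_add, ← mul_add]
    refine mul_le_mul_right ?_ _
    have h2 : g z - g ζ = (g z - g0 z) + (g0 z - g0 ζ) + (g0 ζ - g ζ) := by ring
    rw [h2]
    refine (enorm_add_le _ _).trans (add_le_add (enorm_add_le _ _) ?_)
    rw [← neg_sub, enorm_neg]
  have hm' : Measurable fun p : Sphere d × Sphere d => ‖(g - g0) p.2‖ₑ := hm.comp measurable_snd
  refine (lintegral_mono hle).trans ?_
  rw [lintegral_add_right _ hm, lintegral_add_right _ (measurable_oscillation
    g0.continuous.measurable r), 
    lintegral_lintegral_swap (hP.fun_mul hm').aemeasurable]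
  have h3 : (∫⁻ z : Sphere d, ∫⁻ ζ : Sphere d,
      ENNReal.ofReal (poissonSzego (r • (ζ : Cn d)) z) * ‖(g - g0) z‖ₑ ∂sigma d ∂sigma d) ≤ ε / 3 := by
    refine le_trans (lintegral_mono fun z => ?_) hg0
    rw [lintegral_mul_const _ (measurable_poissonSzego_left r _)]
    exact mul_le_of_le_one_left' (lintegral_poissonSzego_left_le (sphere_norm z).le hr)
  calc _ ≤ ε / 3 + ε / 3 + ε / 3 := by gcongr
    _ = ε := ENNReal.add_thirds ε

end DeBrangesRovnyak
end

/-! ### Poisson–Szegő integrals of measures singular to `σ`. -/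

namespace DeBrangesRovnyak
open scoped ENNReal
variable {d : ℕ}

lemma liminf_add_le_of_tendsto {ι : Type*} {l : Filter ι} [l.NeBot] {a c : ι → ℝ≥0∞} {A : ℝ≥0∞}
    (ha : Tendsto a l (𝓝 A)) : liminf (fun i => a i + c i) l ≤ A + liminf c l := by
  rcases eq_or_ne A ⊤ with rfl | hA
  · simp
  refine ENNReal.le_of_forall_pos_le_add fun η hη _ => ?_
  have h1 : ∀ᶠ i in l, a i ≤ A + η := by
    refine (ha.eventually_lt_const (ENNReal.lt_add_right hA ?_)).mono fun i hi => hi.le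
    exact ENNReal.coe_ne_zero.2 hη.ne'
  calc liminf (fun i => a i + c i) l ≤ liminf (fun i => (A + η) + c i) l :=
        liminf_le_liminf (h1.mono fun i hi => add_le_add_left hi _)
    _ = A + η + liminf c l :=
        liminf_const_add l c (A + η) (by isBoundedDefault) (by isBoundedDefault)
    _ = A + liminf c l + η := add_right_comm _ _ _

/-- The inclusion of the sphere in the closed ball. -/
abbrev sphereIncl (d : ℕ) : Sphere d → ClosedBall d := inclusion sphere_subset_closedBall

lemma measurableEmbedding_sphereIncl : MeasurableEmbedding (sphereIncl d) := by
  have hc : Continuous (sphereIncl d) := continuous_inclusion _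
  refine Topology.IsClosedEmbedding.measurableEmbedding ?_
  exact hc.isClosedEmbedding (inclusion_injective _)

lemma measurable_lintegral_poissonSzego (m : Measure (ClosedBall d)) [SFinite m] (r : ℝ) :
    Measurable fun ζ : Sphere d =>
      ∫⁻ z : ClosedBall d, ENNReal.ofReal (poissonSzego (r • (ζ : Cn d)) z) ∂m :=
  Measurable.lintegral_prod_right' (f := fun p : Sphere d × ClosedBall d =>
    ENNReal.ofReal (poissonSzego (r • (p.1 : Cn d)) p.2)) (measurable_poissonSzego
      ((measurable_subtype_coe.comp measurable_fst).const_smul r)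
      (measurable_subtype_coe.comp measurable_snd))

lemma lintegral_lintegral_poissonSzego_le [NeZero d] (m : Measure (ClosedBall d)) [SFinite m]
    {r : ℝ} (hr : r ∈ Ioo (0 : ℝ) 1) :
    ∫⁻ ζ : Sphere d, ∫⁻ z : ClosedBall d, ENNReal.ofReal (poissonSzego (r • (ζ : Cn d)) z) ∂m
      ∂sigma d ≤ m univ := by
  have hm : Measurable fun p : Sphere d × ClosedBall d =>
      ENNReal.ofReal (poissonSzego (r • (p.1 : Cn d)) p.2) := measurable_poissonSzego
    ((measurable_subtype_coe.comp measurable_fst).const_smul r)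
    (measurable_subtype_coe.comp measurable_snd)
  rw [lintegral_lintegral_swap hm.aemeasurable]
  refine (lintegral_mono fun z => lintegral_poissonSzego_left_le ?_ hr).trans_eq lintegral_one
  exact mem_closedBall_zero_iff.1 z.2

/-- The Poisson--Szegő integral of a measure tends to zero off its closed support. -/
lemma tendsto_setLIntegral_poissonSzego [NeZero d] (m : Measure (ClosedBall d)) [IsFiniteMeasure m]
    {K : Set (ClosedBall d)} (hK : IsClosed K) {ζ : Sphere d} (hζ : sphereIncl d ζ ∉ K) :
    Tendsto (fun r : ℝ => ∫⁻ z in K, ENNReal.ofReal (poissonSzego (r • (ζ : Cn d)) z) ∂m)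
      (𝓝[<] 1) (𝓝 0) := by
  obtain ⟨δ, hδ, hδK⟩ := Metric.isOpen_iff.1 hK.isOpen_compl _ hζ
  have hlim := ENNReal.Tendsto.mul_const (tendsto_poissonSzego_bound (d := d) hδ)
    (b := m K) (Or.inr (measure_ne_top m K))
  rw [zero_mul] at hlim
  refine tendsto_of_tendsto_of_tendsto_of_le_of_le' tendsto_const_nhds hlim
    (Eventually.of_forall fun r => zero_le) ?_
  filter_upwards [Ioo_mem_nhdsLT (zero_lt_one (α := ℝ))] with r hr
  refine (setLIntegral_mono' hK.measurableSet fun z hz => ?_).trans_eq (setLIntegral_const _ _)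
  refine ENNReal.ofReal_le_ofReal (poissonSzego_le hr ζ (mem_closedBall_zero_iff.1 z.2) hδ ?_)
  by_contra h
  refine hδK (?_ : z ∈ ball _ _) hz
  rw [mem_ball, Subtype.dist_eq, dist_eq_norm]
  exact not_le.1 h

/-- The Poisson--Szegő integral of a measure singular to `σ`, together with a perturbation that is
small in `L¹(σ)`, has vanishing lower radial limits almost everywhere. -/
lemma ae_liminf_poissonSzego_eq_zero [NeZero d] (m : Measure (ClosedBall d)) [IsFiniteMeasure m]
    {N : Set (ClosedBall d)} (hN : MeasurableSet N) (hmN : m Nᶜ = 0)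
    (hσN : sigma d (sphereIncl d ⁻¹' N) = 0) {B : ℝ → Sphere d → ℝ≥0∞} (hBm : ∀ r, Measurable (B r))
    (hB : Tendsto (fun r => ∫⁻ ζ, B r ζ ∂sigma d) (𝓝[<] 1) (𝓝 0))
    {u : ℕ → ℝ} (hu : Tendsto u atTop (𝓝[<] 1)) :
    ∀ᵐ ζ : Sphere d ∂sigma d, liminf (fun n => (∫⁻ z : ClosedBall d,
      ENNReal.ofReal (poissonSzego (u n • (ζ : Cn d)) z) ∂m) + B (u n) ζ) atTop = 0 := by
  have hmeas : Measurable fun ζ : Sphere d => liminf (fun n => (∫⁻ z : ClosedBall d,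
      ENNReal.ofReal (poissonSzego (u n • (ζ : Cn d)) z) ∂m) + B (u n) ζ) atTop :=
    .liminf fun n => (measurable_lintegral_poissonSzego m (u n)).add (hBm _)
  refine (lintegral_eq_zero_iff hmeas).1 (nonpos_iff_eq_zero.1 ?_)
  refine le_of_forall_gt_imp_ge_of_dense fun ε hε => ?_
  -- Inner regularity leaves mass at most `ε` off a closed `K ⊆ N`. The mass on `K` contributes
  -- nothing in the limit at points off `K`, hence `σ`-a.e. The remaining mass and the perturbation
  -- `B` are controlled only in `L¹(σ)`, which is enough for Fatou's lemma. They are kept in a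
  -- single `liminf` because lower limits of a sum do not split.
  obtain ⟨K, hKN, hK, hKε⟩ := hN.exists_isClosed_sdiff_lt (measure_ne_top m N) hε.ne'
  have hKc : m Kᶜ ≤ ε := by
    have hsub : Kᶜ ⊆ (N \ K) ∪ Nᶜ := fun z hz => by
      by_cases h : z ∈ N
      · exact Or.inl ⟨h, hz⟩
      · exact Or.inr h
    refine (measure_mono hsub).trans ((measure_union_le _ _).trans ?_)
    rw [hmN, add_zero]
    exact hKε.le
  have hae : ∀ᵐ ζ : Sphere d ∂sigma d, liminf (fun n => (∫⁻ z : ClosedBall d,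
      ENNReal.ofReal (poissonSzego (u n • (ζ : Cn d)) z) ∂m) + B (u n) ζ) atTop ≤
      liminf (fun n => (∫⁻ z in Kᶜ, ENNReal.ofReal (poissonSzego (u n • (ζ : Cn d)) z) ∂m) +
        B (u n) ζ) atTop := by
    have h0 : ∀ᵐ ζ ∂sigma d, ζ ∉ sphereIncl d ⁻¹' K :=
      measure_eq_zero_iff_ae_notMem.1 (measure_mono_null (preimage_mono hKN) hσN)
    filter_upwards [h0] with ζ hζ
    have h1 := liminf_add_le_of_tendsto (c := fun n =>
      (∫⁻ z in Kᶜ, ENNReal.ofReal (poissonSzego (u n • (ζ : Cn d)) z) ∂m) + B (u n) ζ)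
      ((tendsto_setLIntegral_poissonSzego m hK hζ).comp hu)
    rw [zero_add] at h1
    refine le_of_eq_of_le (congrArg (fun F => liminf F atTop) (funext fun n => ?_)) h1
    rw [Function.comp_apply, ← add_assoc, lintegral_add_compl _ hK.measurableSet]
  refine (lintegral_mono_ae hae).trans ((lintegral_liminf_le fun n =>
    (measurable_lintegral_poissonSzego _ (u n)).add (hBm _)).trans ?_)
  have hev : ∀ᶠ n in atTop, (∫⁻ ζ : Sphere d, ((∫⁻ z in Kᶜ,
      ENNReal.ofReal (poissonSzego (u n • (ζ : Cn d)) z) ∂m) + B (u n) ζ) ∂sigma d) ≤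
      ε + ∫⁻ ζ, B (u n) ζ ∂sigma d := by
    filter_upwards [hu (Ioo_mem_nhdsLT (zero_lt_one (α := ℝ)))] with n hn
    rw [lintegral_add_right _ (hBm _)]
    refine add_le_add_left ((lintegral_lintegral_poissonSzego_le _ hn).trans ?_) _
    rwa [Measure.restrict_apply_univ]
  have hlim : Tendsto (fun n => ε + ∫⁻ ζ, B (u n) ζ ∂sigma d) atTop (𝓝 (ε + 0)) :=
    (hB.comp hu).const_add ε
  rw [add_zero] at hlim
  exact (liminf_le_liminf hev).trans_eq hlim.liminf_eq

end DeBrangesRovnyak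

/-! ### The reverse Carleson inequality tested on reproducing kernels. -/

noncomputable section
namespace DeBrangesRovnyak
open scoped ENNReal
variable {d : ℕ}

/-- The weight that normalizes the kernel of `𝓗(b)` converts its squared Szegő denominator into the
Poisson–Szegő kernel. This also holds for `z` on the sphere, since only `|w| < 1` matters. -/
lemma poissonSzego_mul_enorm_sq {w : Cn d} (hw : ‖w‖ < 1) (z : Cn d) (c : ℂ) :
    ENNReal.ofReal ((1 - ‖w‖ ^ 2) ^ d) * ‖c / (1 - ⟪w, z⟫_ℂ) ^ d‖ₑ ^ 2 =
      ENNReal.ofReal (poissonSzego w z) * ‖c‖ₑ ^ 2 := by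
  have h0 : 0 < 1 - ‖w‖ ^ 2 := by nlinarith [norm_nonneg w]
  rw [← ofReal_norm, ← ofReal_norm, ← ENNReal.ofReal_pow (norm_nonneg _),
    ← ENNReal.ofReal_pow (norm_nonneg _), ← ENNReal.ofReal_mul (by positivity),
    ← ENNReal.ofReal_mul (poissonSzego_nonneg hw.le z), poissonSzego, norm_div, norm_pow, div_pow,
    ← pow_mul, mul_comm d 2]
  congr 1
  ring

lemma enorm_sq_one_sub_mul_le {a c : ℂ} (ha : ‖a‖ ≤ 1) (hc : ‖c‖ ≤ 1) :
    ‖1 - a * conj c‖ₑ ^ 2 ≤ 4 := by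
  have h : ‖1 - a * conj c‖ ≤ 2 := by
    refine (norm_sub_le _ _).trans ?_
    rw [norm_one, norm_mul, RCLike.norm_conj]
    nlinarith [norm_nonneg a, norm_nonneg c]
  rw [← ofReal_norm, ← ENNReal.ofReal_pow (norm_nonneg _)]
  refine (ENNReal.ofReal_le_ofReal (?_ : _ ≤ (4 : ℝ))).trans (by simp)
  nlinarith [norm_nonneg (1 - a * conj c)]

/-- The part of a measure on the closed ball that is singular to `σ`. -/
def singularRest (μ : Measure (ClosedBall d)) : Measure (ClosedBall d) :=
  μ.restrict (range (sphereIncl d))ᶜ + ((restrictSphere μ).singularPart (sigma d)).map (sphereIncl d)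

instance (μ : Measure (ClosedBall d)) [IsFiniteMeasure μ] : IsFiniteMeasure (restrictSphere μ) :=
  ⟨by
    rw [restrictSphere, measurableEmbedding_sphereIncl.comap_apply]
    exact measure_lt_top _ _⟩

instance (μ : Measure (ClosedBall d)) [IsFiniteMeasure μ] : IsFiniteMeasure (singularRest μ) := by
  unfold singularRest
  infer_instance

/-- The open ball can be put into the carrier for free, since it does not meet the sphere. What is
added on the sphere is the `σ`-null set carrying the singular part. -/
lemma exists_singularRest_null (μ : Measure (ClosedBall d)) :
    ∃ N : Set (ClosedBall d), MeasurableSet N ∧ singularRest μ Nᶜ = 0 ∧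
      sigma d (sphereIncl d ⁻¹' N) = 0 := by
  obtain ⟨s, hs, hs1, hs2⟩ := (restrictSphere μ).mutuallySingular_singularPart (sigma d)
  have hE := measurableEmbedding_sphereIncl (d := d)
  refine ⟨(range (sphereIncl d))ᶜ ∪ sphereIncl d '' sᶜ,
    hE.measurableSet_range.compl.union (hE.measurableSet_image.2 hs.compl), ?_, ?_⟩
  · rw [compl_union, compl_compl, singularRest, Measure.add_apply, hE.map_apply,
      Measure.restrict_apply (hE.measurableSet_range.inter (hE.measurableSet_image.2 hs.compl).compl)]
    have h1 : range (sphereIncl d) ∩ (sphereIncl d '' sᶜ)ᶜ ∩ (range (sphereIncl d))ᶜ = ∅ := by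
      ext x; simp; tauto
    have h2 : sphereIncl d ⁻¹' (range (sphereIncl d) ∩ (sphereIncl d '' sᶜ)ᶜ) = s := by
      ext x
      simp [hE.injective.mem_set_image]
    rw [h1, h2, hs1, measure_empty, add_zero]
  · have h2 : sphereIncl d ⁻¹' ((range (sphereIncl d))ᶜ ∪ sphereIncl d '' sᶜ) = sᶜ := by
      ext x
      simp [hE.injective.mem_set_image]
    rw [h2, hs2]

lemma mem_sphere_iff_mem_range (z : ClosedBall d) :
    (z : Cn d) ∈ sphere (0 : Cn d) 1 ↔ z ∈ range (sphereIncl d) := by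
  constructor
  · exact fun h => ⟨⟨z, h⟩, rfl⟩
  · rintro ⟨ζ, rfl⟩
    exact ζ.2

variable [NeZero d]

/-- The kernel function of `𝓗(b)` at the point `w`. -/
abbrev kernelVec (b : SchurFunction d) (w : Ball d) : HSpace b := RKHS.kerFun (HSpace b) w 1

lemma kernelVec_apply (b : SchurFunction d) (w z : Ball d) :
    (kernelVec b w : Ball d → ℂ) z = kernelFun b z w :=
  (RKHS.kerFun_apply (HSpace b) w 1 z).trans (kernel_HSpace b z w)

lemma norm_kernelVec_sq (b : SchurFunction d) (w : Ball d) :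
    ‖kernelVec b w‖ ^ 2 = (1 - ‖b w‖ ^ 2) / (1 - ‖(w : Cn d)‖ ^ 2) ^ d := by
  have h1 : ⟪kernelVec b w, kernelVec b w⟫_ℂ = kernelFun b w w := by
    rw [kernelVec, RKHS.kerFun_inner, kernelVec_apply]
    simp
  rw [inner_self_eq_norm_sq_to_K, kernelFun, inner_self_eq_norm_sq_to_K, Complex.mul_conj,
    Complex.normSq_eq_norm_sq] at h1
  apply Complex.ofReal_injective
  push_cast
  simpa using h1

lemma extendZero_kernelVec (b : SchurFunction d) (w : Ball d) {z : Cn d}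
    (hz : z ∈ ball (0 : Cn d) 1) :
    extendZero (kernelVec b w : Ball d → ℂ) z =
      (1 - extendZero b z * conj (b w)) / (1 - ⟪(w : Cn d), z⟫_ℂ) ^ d := by
  have h1 := extendZero_coe (kernelVec b w : Ball d → ℂ) ⟨z, hz⟩
  have h2 := extendZero_coe b ⟨z, hz⟩
  rw [kernelVec_apply] at h1
  rw [h1, h2, kernelFun]

lemma isHolomorphic_kernelVec (b : SchurFunction d) (w : Ball d) :
    IsHolomorphic (kernelVec b w : Ball d → ℂ) := by
  have h1 : DifferentiableOn ℂ (fun z => (1 - extendZero b z * conj (b w)) /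
      (1 - ⟪(w : Cn d), z⟫_ℂ) ^ d) (ball (0 : Cn d) 1) := by
    have hd : Differentiable ℂ fun z : Cn d => (1 - ⟪(w : Cn d), z⟫_ℂ) ^ d :=
      ((differentiable_const 1).sub (innerSL ℂ (w : Cn d)).differentiable).pow d
    simp only [div_eq_mul_inv]
    refine ((b.holomorphic.mul_const _).const_sub 1).fun_mul
      (hd.differentiableOn.fun_inv fun z hz => ?_)
    exact pow_ne_zero _ (norm_pos_iff.1 (norm_one_sub_inner_pos (mem_ball_zero_iff.1 w.2)
      (mem_ball_zero_iff.1 hz).le))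
  exact h1.congr fun z hz => extendZero_kernelVec b w hz

lemma hasRadialLimit_kernelVec (b : SchurFunction d) (w : Ball d) {ζ : Sphere d} {l : ℂ}
    (h : HasRadialLimit b ζ l) :
    HasRadialLimit (kernelVec b w : Ball d → ℂ) ζ
      ((1 - l * conj (b w)) / (1 - ⟪(w : Cn d), (ζ : Cn d)⟫_ℂ) ^ d) := by
  have h2 : Tendsto (fun r : ℝ => (1 - ⟪(w : Cn d), r • (ζ : Cn d)⟫_ℂ) ^ d) (𝓝[<] 1)
      (𝓝 ((1 - ⟪(w : Cn d), (1 : ℝ) • (ζ : Cn d)⟫_ℂ) ^ d)) :=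
    (Continuous.tendsto (by fun_prop) 1).mono_left nhdsWithin_le_nhds
  rw [one_smul] at h2
  have hne := pow_ne_zero d (norm_pos_iff.1 (norm_one_sub_inner_pos
    (mem_ball_zero_iff.1 w.2) (sphere_norm ζ).le))
  refine (((h.mul_const (conj (b w))).const_sub 1).div h2 hne).congr' ?_
  filter_upwards [Ioo_mem_nhdsLT (zero_lt_one (α := ℝ))] with r hr
  exact (extendZero_kernelVec b w (smul_mem_ball hr (sphere_norm ζ))).symm

/-- The weighted `L²(μ)`-norm of a kernel function, split along the Lebesgue decomposition. -/
lemma lintegral_toClosedBall_kernelVec_le (μ : Measure (ClosedBall d)) [IsFiniteMeasure μ]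
    (b : SchurFunction d) (hμ : IsAdmissible μ b) {v : Sphere d → ℂ} (hv : Measurable v)
    (hvb : boundaryValue b =ᵐ[sigma d] v) (w : Ball d) :
    ENNReal.ofReal ((1 - ‖(w : Cn d)‖ ^ 2) ^ d) *
      ∫⁻ z, ‖toClosedBall (kernelVec b w : Ball d → ℂ) z‖ₑ ^ 2 ∂μ ≤
    4 * (∫⁻ z, ENNReal.ofReal (poissonSzego (w : Cn d) z) ∂singularRest μ) +
      ∫⁻ ζ : Sphere d, ENNReal.ofReal (poissonSzego (w : Cn d) ζ) *
        (‖1 - v ζ * conj (b w)‖ₑ ^ 2 * (restrictSphere μ).rnDeriv (sigma d) ζ) ∂sigma d := by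
  have hE := measurableEmbedding_sphereIncl (d := d)
  have hw : ‖(w : Cn d)‖ < 1 := mem_ball_zero_iff.1 w.2
  set ρ := restrictSphere μ with hρ
  have hdec : ρ.HaveLebesgueDecomposition (sigma d) :=
    Measure.haveLebesgueDecomposition_of_sigmaFinite (restrictSphere μ) _
  set Φ : ClosedBall d → ℝ≥0∞ := fun z => ENNReal.ofReal ((1 - ‖(w : Cn d)‖ ^ 2) ^ d) *
    ‖toClosedBall (kernelVec b w : Ball d → ℂ) z‖ₑ ^ 2 with hΦ
  rw [← lintegral_const_mul' _ _ ENNReal.ofReal_ne_top]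
  change ∫⁻ z, Φ z ∂μ ≤ _
  rw [← lintegral_add_compl Φ hE.measurableSet_range]
  have hin : ∫⁻ z in (range (sphereIncl d))ᶜ, Φ z ∂μ ≤
      4 * ∫⁻ z in (range (sphereIncl d))ᶜ, ENNReal.ofReal (poissonSzego (w : Cn d) z) ∂μ := by
    rw [← lintegral_const_mul' _ _ (by simp)]
    refine setLIntegral_mono' hE.measurableSet_range.compl fun z hz => ?_
    have hzs : (z : Cn d) ∉ sphere (0 : Cn d) 1 := fun h => hz ((mem_sphere_iff_mem_range z).1 h)
    have hzb : (z : Cn d) ∈ ball (0 : Cn d) 1 := by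
      rw [mem_ball_zero_iff]
      refine lt_of_le_of_ne (mem_closedBall_zero_iff.1 z.2) fun h => hzs ?_
      exact mem_sphere_zero_iff_norm.2 h
    simp only [hΦ]
    rw [toClosedBall, dif_neg hzs, extendZero_kernelVec b w hzb, poissonSzego_mul_enorm_sq hw,
      mul_comm]
    gcongr
    exact enorm_sq_one_sub_mul_le (norm_extendZero_le b _) (b.norm_lt_one w).le
  set Ψ : Sphere d → ℝ≥0∞ := fun ζ => ENNReal.ofReal (poissonSzego (w : Cn d) ζ) *
    ‖1 - boundaryValue b ζ * conj (b w)‖ₑ ^ 2 with hΨ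
  -- Admissibility of `b` is used here: at almost every point of the sphere for the restricted
  -- measure, the boundary value of the kernel function comes from that of `b`.
  have hout : ∫⁻ z in range (sphereIncl d), Φ z ∂μ = ∫⁻ ζ, Ψ ζ ∂ρ := by
    rw [← hE.map_comap, hE.lintegral_map]
    refine lintegral_congr_ae ?_
    filter_upwards [hμ.2] with ζ hζ
    have hb := hasRadialLimit_kernelVec b w (hasRadialLimit_boundaryValue hζ)
    simp only [hΦ, hΨ]
    rw [toClosedBall, dif_pos ζ.2]
    have he : (⟨(sphereIncl d ζ : Cn d), ζ.2⟩ : Sphere d) = ζ := rfl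
    rw [he, boundaryValue_eq hb, poissonSzego_mul_enorm_sq hw]
  have hsing : ∫⁻ ζ, Ψ ζ ∂ρ.singularPart (sigma d) ≤ 4 * ∫⁻ z,
      ENNReal.ofReal (poissonSzego (w : Cn d) z) ∂(ρ.singularPart (sigma d)).map (sphereIncl d) := by
    rw [hE.lintegral_map, ← lintegral_const_mul' _ _ (by simp)]
    refine lintegral_mono fun ζ => ?_
    simp only [hΨ]
    rw [mul_comm]
    gcongr
    · exact enorm_sq_one_sub_mul_le (norm_boundaryValue_le b ζ) (b.norm_lt_one w).le
  -- Only this part keeps its exact factor `|1 - v conj b(w)|²`; the bound `4` used elsewhere would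
  -- lose the second factor `1 - |b|²` in the limit. The measurable version `v` may replace the
  -- boundary value because the measure is absolutely continuous.
  have hac : ∫⁻ ζ, Ψ ζ ∂(sigma d).withDensity (ρ.rnDeriv (sigma d)) =
      ∫⁻ ζ : Sphere d, ENNReal.ofReal (poissonSzego (w : Cn d) ζ) *
        (‖1 - v ζ * conj (b w)‖ₑ ^ 2 * ρ.rnDeriv (sigma d) ζ) ∂sigma d := by
    have hm : Measurable fun ζ : Sphere d => ENNReal.ofReal (poissonSzego (w : Cn d) ζ) *
        ‖1 - v ζ * conj (b w)‖ₑ ^ 2 :=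
      (measurable_poissonSzego_right _).mul (((hv.mul_const _).const_sub 1).enorm.pow_const 2)
    have hcongr : Ψ =ᵐ[(sigma d).withDensity (ρ.rnDeriv (sigma d))] fun ζ : Sphere d =>
        ENNReal.ofReal (poissonSzego (w : Cn d) ζ) * ‖1 - v ζ * conj (b w)‖ₑ ^ 2 := by
      filter_upwards [(withDensity_absolutelyContinuous _ _).ae_le hvb] with ζ hζ
      simp only [hΨ, hζ]
    rw [lintegral_congr_ae hcongr,
      lintegral_withDensity_eq_lintegral_mul _ (Measure.measurable_rnDeriv _ _) hm]
    refine lintegral_congr fun ζ => ?_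
    simp only [Pi.mul_apply]
    ring
  have hsum : ∫⁻ ζ, Ψ ζ ∂ρ = ∫⁻ ζ, Ψ ζ ∂ρ.singularPart (sigma d) +
      ∫⁻ ζ, Ψ ζ ∂(sigma d).withDensity (ρ.rnDeriv (sigma d)) := by
    rw [← lintegral_add_measure, ρ.singularPart_add_rnDeriv (sigma d)]
  rw [hout, hsum, hac, singularRest, lintegral_add_measure, mul_add, add_comm (_ + _),
    ← add_assoc]
  gcongr

/-- The reverse Carleson inequality on kernel functions. -/
lemma one_sub_norm_sq_le_of_isReverseCarleson (μ : Measure (ClosedBall d)) [IsFiniteMeasure μ]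
    (b : SchurFunction d) (hμ : IsAdmissible μ b) {C : ℝ≥0}
    (hC : ∀ f : HSpace b, IsAdmissible μ (f : Ball d → ℂ) →
      ‖f‖ₑ ≤ C * eLpNorm (toClosedBall (f : Ball d → ℂ)) 2 μ)
    {v : Sphere d → ℂ} (hv : Measurable v) (hvb : boundaryValue b =ᵐ[sigma d] v) (w : Ball d) :
    ENNReal.ofReal (1 - ‖b w‖ ^ 2) ≤ C ^ 2 *
      (4 * (∫⁻ z, ENNReal.ofReal (poissonSzego (w : Cn d) z) ∂singularRest μ) +
      ∫⁻ ζ : Sphere d, ENNReal.ofReal (poissonSzego (w : Cn d) ζ) *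
        (‖1 - v ζ * conj (b w)‖ₑ ^ 2 * (restrictSphere μ).rnDeriv (sigma d) ζ) ∂sigma d) := by
  have hw : ‖(w : Cn d)‖ < 1 := mem_ball_zero_iff.1 w.2
  have h0 : 0 < 1 - ‖(w : Cn d)‖ ^ 2 := by nlinarith [norm_nonneg (w : Cn d)]
  have hadm : IsAdmissible μ (kernelVec b w : Ball d → ℂ) := by
    refine ⟨isHolomorphic_kernelVec b w, ?_⟩
    filter_upwards [hμ.2] with ζ hζ
    exact ⟨_, hasRadialLimit_kernelVec b w (hasRadialLimit_boundaryValue hζ)⟩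
  have h1 := pow_le_pow_left' (hC _ hadm) 2
  have h2 : eLpNorm (toClosedBall (kernelVec b w : Ball d → ℂ)) 2 μ ^ 2 =
      ∫⁻ z, ‖toClosedBall (kernelVec b w : Ball d → ℂ) z‖ₑ ^ 2 ∂μ := by
    simpa using eLpNorm_nnreal_pow_eq_lintegral (μ := μ)
      (f := toClosedBall (kernelVec b w : Ball d → ℂ)) (p := 2) two_ne_zero
  rw [mul_pow, h2, ← ofReal_norm, ← ENNReal.ofReal_pow (norm_nonneg _),
    norm_kernelVec_sq] at h1
  have h3 : ENNReal.ofReal (1 - ‖b w‖ ^ 2) = ENNReal.ofReal ((1 - ‖(w : Cn d)‖ ^ 2) ^ d) *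
      ENNReal.ofReal ((1 - ‖b w‖ ^ 2) / (1 - ‖(w : Cn d)‖ ^ 2) ^ d) := by
    rw [← ENNReal.ofReal_mul (by positivity), mul_div_cancel₀ _ (by positivity)]
  rw [h3]
  refine (mul_le_mul_right h1 _).trans ?_
  rw [mul_left_comm]
  gcongr
  exact lintegral_toClosedBall_kernelVec_le μ b hμ hv hvb w

end DeBrangesRovnyak

end

/-! ### Passage to the boundary. -/

namespace DeBrangesRovnyak
open scoped ENNReal
variable {d : ℕ} [NeZero d]

/-- Expanding the square, `h |1 - u conj β|²` is a linear expression in `h`, `hu` and `h|u|²` with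
coefficients controlled by `|β| ≤ 1`. The bound is uniform in `β`, so the value `b(rζ)`, which moves
with `r`, can be treated with three fixed functions. -/
lemma norm_sq_one_sub_mul_sub (h₁ h₂ : ℝ) (u₁ u₂ β : ℂ) (hβ : ‖β‖ ≤ 1) :
    ‖1 - u₁ * conj β‖ ^ 2 * h₁ ≤ ‖1 - u₂ * conj β‖ ^ 2 * h₂ + (‖(h₁ : ℂ) - h₂‖ +
      2 * ‖(h₁ : ℂ) * u₁ - h₂ * u₂‖ + ‖((h₁ * ‖u₁‖ ^ 2 : ℝ) : ℂ) - (h₂ * ‖u₂‖ ^ 2 : ℝ)‖) := by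
  have hexp : ∀ u : ℂ, ‖1 - u * conj β‖ ^ 2 = 1 - 2 * (u * conj β).re + ‖u‖ ^ 2 * ‖β‖ ^ 2 := by
    intro u
    rw [← Complex.normSq_eq_norm_sq, Complex.normSq_sub, ← mul_pow, ← RCLike.norm_conj β,
      ← norm_mul, ← Complex.normSq_eq_norm_sq]
    simp
    ring
  have h1 : h₁ - h₂ ≤ ‖(h₁ : ℂ) - h₂‖ := by
    rw [← Complex.ofReal_sub, Complex.norm_real]
    exact le_abs_self _
  have h2 : -(((h₁ : ℂ) * u₁ - h₂ * u₂) * conj β).re ≤ ‖(h₁ : ℂ) * u₁ - h₂ * u₂‖ := by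
    refine ((neg_le_abs _).trans (Complex.abs_re_le_norm _)).trans ?_
    rw [norm_mul, RCLike.norm_conj]
    exact mul_le_of_le_one_right (norm_nonneg _) hβ
  have h3 : (h₁ * ‖u₁‖ ^ 2 - h₂ * ‖u₂‖ ^ 2) * ‖β‖ ^ 2 ≤
      ‖((h₁ * ‖u₁‖ ^ 2 : ℝ) : ℂ) - (h₂ * ‖u₂‖ ^ 2 : ℝ)‖ := by
    rw [← Complex.ofReal_sub, Complex.norm_real, Real.norm_eq_abs]
    refine (mul_le_mul_of_nonneg_right (le_abs_self _) (by positivity)).trans ?_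
    refine mul_le_of_le_one_right (abs_nonneg _) ?_
    exact pow_le_one₀ (norm_nonneg _) hβ
  have h4 : (((h₁ : ℂ) * u₁ - h₂ * u₂) * conj β).re =
      h₁ * (u₁ * conj β).re - h₂ * (u₂ * conj β).re := by
    rw [sub_mul, Complex.sub_re, mul_assoc, mul_assoc, Complex.re_ofReal_mul,
      Complex.re_ofReal_mul]
  rw [h4] at h2
  rw [hexp, hexp]
  linarith

lemma lintegral_poissonSzego_mul_le {v : Sphere d → ℂ} (hv : Measurable v) {h : Sphere d → ℝ}
    (hh : Measurable h) {w : Cn d} {r : ℝ} (hr : r ∈ Ioo (0 : ℝ) 1) (ζ : Sphere d)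
    (hw : w = r • (ζ : Cn d)) {β : ℂ} (hβ : ‖β‖ ≤ 1) :
    ∫⁻ z : Sphere d, ENNReal.ofReal (poissonSzego w z) *
        ENNReal.ofReal (‖1 - v z * conj β‖ ^ 2 * h z) ∂sigma d ≤
      ENNReal.ofReal (‖1 - v ζ * conj β‖ ^ 2 * h ζ) + (oscillation (fun z => (h z : ℂ)) r ζ +
        2 * oscillation (fun z => (h z : ℂ) * v z) r ζ +
        oscillation (fun z => ((h z * ‖v z‖ ^ 2 : ℝ) : ℂ)) r ζ) := by
  have hP := measurable_poissonSzego_right w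
  have hhc : Measurable fun z => (h z : ℂ) := Complex.measurable_ofReal.comp hh
  have hhv : Measurable fun z => (h z : ℂ) * v z := hhc.mul hv
  have hhvv : Measurable fun z => ((h z * ‖v z‖ ^ 2 : ℝ) : ℂ) :=
    Complex.measurable_ofReal.comp (hh.mul (hv.norm.pow_const 2))
  have e1 : ENNReal.ofReal (‖1 - v ζ * conj β‖ ^ 2 * h ζ) = ∫⁻ z : Sphere d,
      ENNReal.ofReal (poissonSzego w z) * ENNReal.ofReal (‖1 - v ζ * conj β‖ ^ 2 * h ζ)
        ∂sigma d := by
    rw [lintegral_mul_const _ hP, lintegral_poissonSzego_right (hw ▸ norm_lt_one_smul hr ζ), one_mul]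
  rw [e1]
  simp only [oscillation, ← hw]
  have hm1 : Measurable fun z : Sphere d => ENNReal.ofReal (poissonSzego w z) *
      ‖(h z : ℂ) - h ζ‖ₑ := hP.fun_mul (hhc.sub_const _).enorm
  have hm2 : Measurable fun z : Sphere d => 2 * (ENNReal.ofReal (poissonSzego w z) *
      ‖(h z : ℂ) * v z - h ζ * v ζ‖ₑ) := (hP.fun_mul (hhv.sub_const _).enorm).const_mul 2
  rw [← lintegral_const_mul' _ _ (by simp), ← lintegral_add_right _ hm2,
    ← lintegral_add_left (hm1.fun_add hm2), ← lintegral_add_left (hP.mul_const _)]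
  refine lintegral_mono fun z => ?_
  have key := norm_sq_one_sub_mul_sub (h z) (h ζ) (v z) (v ζ) β hβ
  have key2 := (ENNReal.ofReal_le_ofReal key).trans ENNReal.ofReal_add_le
  rw [ENNReal.ofReal_add (by positivity) (by positivity),
    ENNReal.ofReal_add (by positivity) (by positivity), ENNReal.ofReal_mul zero_le_two,
    ofReal_norm, ofReal_norm, ofReal_norm, ENNReal.ofReal_ofNat] at key2
  refine (mul_le_mul_right key2 _).trans_eq ?_
  ring

/-- The reverse Carleson inequality passes to radial limits: the singular part of the measure
disappears. -/
lemma ae_one_sub_norm_sq_le (μ : Measure (ClosedBall d)) [IsFiniteMeasure μ]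
    (b : SchurFunction d) (hμ : IsAdmissible μ b) {C : ℝ≥0}
    (hC : ∀ f : HSpace b, IsAdmissible μ (f : Ball d → ℂ) →
      ‖f‖ₑ ≤ C * eLpNorm (toClosedBall (f : Ball d → ℂ)) 2 μ) :
    ∀ᵐ ζ ∂sigma d, ENNReal.ofReal (1 - ‖boundaryValue b ζ‖ ^ 2) ≤ C ^ 2 *
      ENNReal.ofReal ((1 - ‖boundaryValue b ζ‖ ^ 2) ^ 2 *
        ((restrictSphere μ).rnDeriv (sigma d) ζ).toReal) := by
  have hlim := ae_exists_hasRadialLimit b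
  have hbm : AEMeasurable (boundaryValue b) (sigma d) :=
    aemeasurable_boundaryValue b.holomorphic hlim
  set v := hbm.mk with hvdef
  have hv : Measurable v := hbm.measurable_mk
  have hvb : boundaryValue b =ᵐ[sigma d] v := hbm.ae_eq_mk
  set D := (restrictSphere μ).rnDeriv (sigma d) with hD
  have hDm : Measurable D := Measure.measurable_rnDeriv _ _
  have hDtop : ∀ᵐ ζ ∂sigma d, D ζ ≠ ⊤ := Measure.rnDeriv_ne_top _ _
  set h : Sphere d → ℝ := fun ζ => (D ζ).toReal with hh
  have hhm : Measurable h := hDm.ennreal_toReal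
  have hhi : Integrable h (sigma d) := Measure.integrable_toReal_rnDeriv
  have hv1 : ∀ᵐ ζ ∂sigma d, ‖v ζ‖ ≤ 1 := by
    filter_upwards [hvb] with ζ hζ
    rw [← hζ]
    exact norm_boundaryValue_le b ζ
  have hm1 : Measurable fun z => (h z : ℂ) := Complex.measurable_ofReal.comp hhm
  have hm2 : Measurable fun z => (h z : ℂ) * v z := hm1.mul hv
  have hm3 : Measurable fun z => ((h z * ‖v z‖ ^ 2 : ℝ) : ℂ) :=
    Complex.measurable_ofReal.comp (hhm.mul (hv.norm.pow_const 2))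
  have hi1 : Integrable (fun z => (h z : ℂ)) (sigma d) := hhi.ofReal
  have hi2 : Integrable (fun z => (h z : ℂ) * v z) (sigma d) := by
    refine hi1.mono hm2.aestronglyMeasurable ?_
    filter_upwards [hv1] with z hz
    rw [norm_mul]
    exact mul_le_of_le_one_right (norm_nonneg _) hz
  have hi3 : Integrable (fun z => ((h z * ‖v z‖ ^ 2 : ℝ) : ℂ)) (sigma d) := by
    refine hi1.mono hm3.aestronglyMeasurable ?_
    filter_upwards [hv1] with z hz
    rw [Complex.ofReal_mul, norm_mul]
    refine mul_le_of_le_one_right (norm_nonneg _) ?_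
    rw [Complex.norm_real, Real.norm_eq_abs, abs_of_nonneg (by positivity)]
    exact pow_le_one₀ (norm_nonneg _) hz
  -- The total oscillation of `h`, `hv` and `h|v|²`. All three are integrable because `|v| ≤ 1`
  -- a.e., so `B r` tends to `0` in `L¹(σ)`.
  set B : ℝ → Sphere d → ℝ≥0∞ := fun r ζ => oscillation (fun z => (h z : ℂ)) r ζ +
    2 * oscillation (fun z => (h z : ℂ) * v z) r ζ +
    oscillation (fun z => ((h z * ‖v z‖ ^ 2 : ℝ) : ℂ)) r ζ with hB
  have ho1 := measurable_oscillation hm1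
  have ho2 := measurable_oscillation hm2
  have ho3 := measurable_oscillation hm3
  have hBm : ∀ r, Measurable (B r) := fun r =>
    ((ho1 r).add ((ho2 r).const_mul 2)).add (ho3 r)
  have hBlim : Tendsto (fun r => ∫⁻ ζ, B r ζ ∂sigma d) (𝓝[<] 1) (𝓝 0) := by
    have hsum : ∀ r, ∫⁻ ζ, B r ζ ∂sigma d =
        ∫⁻ ζ, oscillation (fun z => (h z : ℂ)) r ζ ∂sigma d +
        2 * ∫⁻ ζ, oscillation (fun z => (h z : ℂ) * v z) r ζ ∂sigma d +
        ∫⁻ ζ, oscillation (fun z => ((h z * ‖v z‖ ^ 2 : ℝ) : ℂ)) r ζ ∂sigma d := fun r => by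
      simp only [hB]
      rw [lintegral_add_right _ (ho3 r), lintegral_add_left (ho1 r),
        lintegral_const_mul _ (ho2 r)]
    simp only [hsum]
    have ht := ((tendsto_lintegral_oscillation hm1 hi1).add
      (ENNReal.Tendsto.const_mul (tendsto_lintegral_oscillation hm2 hi2) (a := 2)
        (Or.inr (by simp)))).add (tendsto_lintegral_oscillation hm3 hi3)
    simpa using ht
  obtain ⟨N, hN, hmN, hσN⟩ := exists_singularRest_null μ
  -- Fatou's lemma requires a sequence of radii. Any sequence increasing to `1` will do, since `b`
  -- converges along the whole radius.
  obtain ⟨u, -, hu1, hu2⟩ := exists_seq_strictMono_tendsto' (zero_lt_one (α := ℝ))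
  have hu : Tendsto u atTop (𝓝[<] 1) :=
    tendsto_nhdsWithin_iff.2 ⟨hu2, Eventually.of_forall fun n => (hu1 n).2⟩
  have hmain := ae_liminf_poissonSzego_eq_zero (singularRest μ) hN hmN hσN hBm hBlim hu
  filter_upwards [hmain, hlim, hvb] with ζ hζ hζlim hζv
  have hbl := (hasRadialLimit_boundaryValue hζlim).comp hu
  set β : ℕ → ℂ := fun n => extendZero b (u n • (ζ : Cn d)) with hβ
  have hβl : Tendsto β atTop (𝓝 (boundaryValue b ζ)) := hbl
  set R : ℕ → ℝ≥0∞ := fun n => (∫⁻ z : ClosedBall d,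
      ENNReal.ofReal (poissonSzego (u n • (ζ : Cn d)) z) ∂singularRest μ) + B (u n) ζ with hR
  have hineq : ∀ n, ENNReal.ofReal (1 - ‖β n‖ ^ 2) ≤
      C ^ 2 * ENNReal.ofReal (‖1 - v ζ * conj (β n)‖ ^ 2 * h ζ) + C ^ 2 * 4 * R n := by
    intro n
    have hwb := smul_mem_ball (hu1 n) (sphere_norm ζ)
    have h1 := one_sub_norm_sq_le_of_isReverseCarleson μ b hμ hC hv hvb ⟨_, hwb⟩
    have hbw : b ⟨_, hwb⟩ = β n := (extendZero_coe b ⟨_, hwb⟩).symm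
    rw [hbw] at h1
    have h2 : ∫⁻ z : Sphere d, ENNReal.ofReal (poissonSzego (u n • (ζ : Cn d)) z) *
        (‖1 - v z * conj (β n)‖ₑ ^ 2 * D z) ∂sigma d =
        ∫⁻ z : Sphere d, ENNReal.ofReal (poissonSzego (u n • (ζ : Cn d)) z) *
        ENNReal.ofReal (‖1 - v z * conj (β n)‖ ^ 2 * h z) ∂sigma d := by
      refine lintegral_congr_ae ?_
      filter_upwards [hDtop] with z hz
      rw [ENNReal.ofReal_mul (by positivity), ENNReal.ofReal_pow (norm_nonneg _), ofReal_norm, hh,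
        ENNReal.ofReal_toReal hz]
    have h3 := lintegral_poissonSzego_mul_le hv hhm (hu1 n) ζ rfl
      (norm_extendZero_le b (u n • (ζ : Cn d)))
    refine h1.trans ?_
    rw [h2, mul_assoc, ← mul_add]
    refine mul_le_mul_right ((add_le_add_right h3 _).trans ?_) _
    rw [hR, mul_add, add_left_comm]
    refine add_le_add_right (add_le_add_right ?_ _) _
    -- The oscillation term is enlarged by the factor `4`, so that it joins the singular term in the
    -- single remainder `R`.
    exact le_mul_of_one_le_left zero_le (by norm_num)
  have hL : Tendsto (fun n => ENNReal.ofReal (1 - ‖β n‖ ^ 2)) atTop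
      (𝓝 (ENNReal.ofReal (1 - ‖boundaryValue b ζ‖ ^ 2))) :=
    ENNReal.tendsto_ofReal ((hβl.norm.pow 2).const_sub 1)
  have hX : Tendsto (fun n => C ^ 2 * ENNReal.ofReal (‖1 - v ζ * conj (β n)‖ ^ 2 * h ζ)) atTop
      (𝓝 (C ^ 2 * ENNReal.ofReal (‖1 - v ζ * conj (boundaryValue b ζ)‖ ^ 2 * h ζ))) := by
    refine ENNReal.Tendsto.const_mul (ENNReal.tendsto_ofReal ?_) (Or.inr (by simp))
    have hconj : Tendsto (fun n => conj (β n)) atTop (𝓝 (conj (boundaryValue b ζ))) :=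
      (Complex.continuous_conj.tendsto _).comp hβl
    exact (((hconj.const_mul (v ζ)).const_sub 1).norm.pow 2).mul_const _
  -- The left side and the main term on the right converge, while the remainder has lower limit `0`.
  -- A lower limit therefore suffices for the inequality at `ζ`.
  have hfin := (liminf_le_liminf (Eventually.of_forall hineq)).trans (liminf_add_le_of_tendsto hX)
  rw [hL.liminf_eq, ENNReal.liminf_const_mul_of_ne_top
    (ENNReal.mul_ne_top (by simp) (by simp)), hζ, mul_zero, add_zero, ← hζv] at hfin
  refine hfin.trans_eq ?_
  have hfac : ‖1 - boundaryValue b ζ * conj (boundaryValue b ζ)‖ ^ 2 =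
      (1 - ‖boundaryValue b ζ‖ ^ 2) ^ 2 := by
    rw [Complex.mul_conj, Complex.normSq_eq_norm_sq, ← Complex.ofReal_one, ← Complex.ofReal_sub,
      Complex.norm_real, Real.norm_eq_abs, sq_abs]
  rw [hfac]

end DeBrangesRovnyak

/-! ### The two conclusions. -/

open DeBrangesRovnyak
theorem mainTheorem4 (d : ℕ) [NeZero d] (μ : Measure (ClosedBall d)) [IsFiniteMeasure μ]
    (b : SchurFunction d) (hμ : IsAdmissible μ b) (hb : ¬ IsInner b)
    (hrc : IsReverseCarleson μ b) :
    ¬ ((restrictSphere μ).rnDeriv (sigma d) =ᵐ[sigma d] 0) ∧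
      ∫⁻ ζ in {ζ : Sphere d | ‖boundaryValue b ζ‖ < 1},
        ENNReal.ofReal (1 / (1 - ‖boundaryValue b ζ‖)) ∂sigma d < ⊤ := by
  obtain ⟨C, -, hC⟩ := hrc
  have hmain := ae_one_sub_norm_sq_le μ b hμ hC
  constructor
  · intro h0
    refine hb ?_
    filter_upwards [hmain, h0] with ζ hζ hζ0
    rw [hζ0, Pi.zero_apply, ENNReal.toReal_zero, mul_zero, ENNReal.ofReal_zero, mul_zero,
      nonpos_iff_eq_zero, ENNReal.ofReal_eq_zero] at hζ
    nlinarith [norm_boundaryValue_le b ζ, norm_nonneg (boundaryValue b ζ)]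
  · have hD : ∫⁻ ζ, 2 * C ^ 2 * (restrictSphere μ).rnDeriv (sigma d) ζ ∂sigma d < ⊤ := by
      rw [lintegral_const_mul' _ _ (ENNReal.mul_ne_top (by simp) (by simp))]
      exact ENNReal.mul_lt_top (ENNReal.mul_lt_top (by simp) (by simp))
        (Measure.lintegral_rnDeriv_lt_top _ _)
    -- The boundary value is only almost everywhere measurable, so the set is merely null
    -- measurable.
    have hset : ∀ᵐ ζ ∂(sigma d).restrict {ζ : Sphere d | ‖boundaryValue b ζ‖ < 1},
        ‖boundaryValue b ζ‖ < 1 := by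
      refine ae_restrict_mem₀ ?_
      exact nullMeasurableSet_lt (aemeasurable_boundaryValue b.holomorphic
        (ae_exists_hasRadialLimit b)).norm aemeasurable_const
    refine lt_of_le_of_lt (lintegral_mono_ae ?_) ((setLIntegral_le_lintegral _ _).trans_lt hD)
    filter_upwards [ae_restrict_of_ae hmain, ae_restrict_of_ae
      (Measure.rnDeriv_ne_top (restrictSphere μ) (sigma d)), hset] with ζ hζ hζD h1
    set t := ‖boundaryValue b ζ‖ with ht
    have ht0 : 0 ≤ t := norm_nonneg _
    set h := ((restrictSphere μ).rnDeriv (sigma d) ζ).toReal with hh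
    have hh0 : 0 ≤ h := ENNReal.toReal_nonneg
    rw [← ENNReal.ofReal_toReal hζD, ← hh]
    have hCr : (C : ENNReal) ^ 2 = ENNReal.ofReal ((C : ℝ) ^ 2) := by
      rw [ENNReal.ofReal_pow C.coe_nonneg, ENNReal.ofReal_coe_nnreal]
    rw [hCr, ← ENNReal.ofReal_mul (by positivity),
      ENNReal.ofReal_le_ofReal_iff (by positivity)] at hζ
    rw [hCr, ← ENNReal.ofReal_ofNat 2, ← ENNReal.ofReal_mul zero_le_two,
      ← ENNReal.ofReal_mul (by positivity)]
    refine ENNReal.ofReal_le_ofReal ?_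
    have hpos : 0 < 1 - t := sub_pos.2 h1
    have hpos2 : 0 < 1 - t ^ 2 := by nlinarith
    -- One factor `1 - t²` cancels because it is positive on this set. The bound `1 - t² ≤ 2 (1 -
    -- t)` then accounts for the constant `2 C²`.
    have h2 : 1 ≤ (C : ℝ) ^ 2 * ((1 - t ^ 2) * h) := by
      refine le_of_mul_le_mul_right ?_ hpos2
      linarith
    rw [div_le_iff₀ hpos]
    have h3 : 0 ≤ (C : ℝ) ^ 2 * h * (1 - t) := by positivity
    nlinarith
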